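/- Let $\tilde W=\langle s_0,s_1\mid s_0^2=s_1^2=1\rangle$ be the affine Weyl group of $\mathrm{SL}_2$ (the infinite dihedral group), with length $\ell$ and Bruhat order $\le$. Let $H$ be its Iwahori--Hecke algebra over $\mathbb Z[q^{\pm 1/2}]$, with basis $T_w$ and relations $T_wT_{w'}=T_{ww'}$ if $\ell(ww')=\ell(w)+\ell(w')$ and $(T_s+1)(T_s-q)=0$ for $s\in\{s_0,s_1\}$. Let $$C_w=\sum_{y\le w}(-1)^{\ell(w)-\ell(y)}q^{\frac{\ell(w)}2-\ell(y)}T_y$$ be the Kazhdan--Lusztig basis, with structure constants $C_xC_y=\sum_z h_{x,y,z}C_z$; let $j(\sum_w a_wT_w)=\sum_w\overline{a_w}(-1)^{\ell(w)}q^{-\ell(w)}T_w$, where $\overline{q^{1/2}}=q^{-1/2}$, and $C'_w=(-1)^{\ell(w)}j(C_w)$. Let $a(z)$ be Lusztig's function, the least integer $n\ge 0$ such that $(-q^{1/2})^nh_{x,y,z}\in\mathbb Z[q^{1/2}]$ for all $x,y$, and let $\mathcal D=\{1,s_0,s_1\}$. Let $J$ be Lusztig's asymptotic Hecke algebra with basis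 $\{t_w\}_{w\in\tilde W}$. Consider the completion of $H$ consisting of the sums $\sum_x a_xC'_x$ with $a_x\in\mathbb Z((q^{-1/2}))$ and $a_x\to0$ (for every $N$, $a_x\in q^{-N/2}\,\mathbb Z[[q^{-1/2}]]$ once $\ell(x)$ is large); $j$ extends to it by $j(\sum_x a_xC'_x)=\sum_x\overline{a_x}(-1)^{\ell(x)}C_x$, and $$\phi\Big(\sum_x b_xC_x\Big)=\sum_{x,z\in\tilde W}\ \sum_{d\in\mathcal D,\ a(d)=a(z)}b_xh_{x,d,z}\,t_z .$$ Let $F$ be a non-archimedean local field with ring of integers $\mathcal O$, uniformizer $\pi$, residue field of cardinality $q$ and normalized absolute value $|\cdot|$. Put $K=\mathrm{SL}_2(\mathcal O)$, let $I\subset K$ be the Iwahori subgroup of matrices that are upper triangular modulo $\pi$, and identify $\tilde W$ with $N(A)(F)/A(\mathcal O)$, where $A$ is the diagonal torus, so that $s_0$ is the class of $\begin{pmatrix}0&-1\\1&0\end{pmatrix}$ and $s_0s_1$ is the class of $\mathrm{diag}(\pi,\pi^{-1})$. For $g\in K\,\mathrm{diag}(\pi^n,\pi^{-n})K$ with $n\ge0$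 put $\Delta(g)=q^n$. The Harish-Chandra Schwartz space $\mathcal C$ of $\mathrm{SL}_2(F)$ consists of the functions $f\colon\mathrm{SL}_2(F)\to\mathbb C$ that are bi-invariant under some open compact subgroup and such that for every polynomial function $p\colon \mathrm{SL}_2(F)\to F$ and every $m>0$ there is a constant $C$ with $\Delta(g)\,|f(g)|\,(\log(1+|p(g)|))^m\le C$ for all $g$. **Proposition.** For every $y\in\tilde W$ there is a unique element of the completion of $H$, again denoted $t_y$, whose image under $\phi\circ j$ is $t_y\in J$. Write $t_y=\sum_w b_{y,w}T_w$; the coefficients $b_{y,w}$ are series in $q^{-1/2}$ which converge when $q$ is the cardinality of the residue field. There is a unique function on $\mathrm{SL}_2(F)$ whose value on each double coset $IwI$ is $b_{y,w}$. This function is bi-invariant under $I$ and lies in $\mathcal C$. Moreover, if $y\ne1$ has reduced expression $s_{i_1}\cdots s_{i_n}$ and $y_k=s_{i_1}\cdots s_{i_k}$, then $b_{y,w}=-q^{\frac{n-1}2}\sum_{k=1}^nq^{k-n}c_k(w)$, where $c_k(w)=\frac{(-1)^{\ell(w)}q^{-\ell(w)+1}}{1+q}$ if $w$ starts with $y_k$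 (that is, $\ell(w)=\ell(y_k)+\ell(y_k^{-1}w)$), and otherwise $c_k(w)=\frac{(-1)^{\ell(w)+1}q^{-\ell(w)}}{1+q}$ if $\ell(w)\ge k$ and $c_k(w)=\frac{(-1)^kq^{-k+1}}{1+q}$ if $\ell(w)<k$. -/

import Mathlib

open Matrix ValuativeRel
open scoped MatrixGroups

noncomputable section

namespace AsymptoticHecke

/-! ### The affine Weyl group of `SL₂` -/

/-- The affine Weyl group `W ⋉ X_*(A)` of `SL₂`, i.e. the infinite dihedral group: `r n` is the
translation `π^n` by `n α^∨`, and `sr n` is `s_α π^n`. -/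
abbrev AffineWeyl : Type := DihedralGroup 0

/-- The simple reflections: `s₀ = s_α` and the affine reflection `s₁ = s_α π`. -/
def gen : Fin 2 → AffineWeyl
  | 0 => .sr 0
  | 1 => .sr 1

/-- The element of the affine Weyl group represented by a word in the simple reflections. -/
def wordProd (ω : List (Fin 2)) : AffineWeyl := (ω.map gen).prod

theorem wordProd_append (ω ω' : List (Fin 2)) :
    wordProd (ω ++ ω') = wordProd ω * wordProd ω' := by
  simp [wordProd]

theorem exists_word_r_nat (n : ℕ) : ∃ ω, wordProd ω = .r ((n : ℤ) : ZMod 0) := by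
  induction n with
  | zero => exact ⟨[], rfl⟩
  | succ k ih =>
    obtain ⟨ω, hω⟩ := ih
    refine ⟨ω ++ [0, 1], ?_⟩
    rw [wordProd_append, hω]
    refine congrArg (fun m : ℤ => (DihedralGroup.r m : AffineWeyl)) ?_
    change (k : ℤ) + (1 - 0) = ((k + 1 : ℕ) : ℤ)
    push_cast
    ring

theorem exists_word_r_neg (n : ℕ) : ∃ ω, wordProd ω = .r ((-(n : ℤ) : ℤ) : ZMod 0) := by
  induction n with
  | zero => exact ⟨[], rfl⟩
  | succ k ih =>
    obtain ⟨ω, hω⟩ := ih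
    refine ⟨ω ++ [1, 0], ?_⟩
    rw [wordProd_append, hω]
    refine congrArg (fun m : ℤ => (DihedralGroup.r m : AffineWeyl)) ?_
    change -(k : ℤ) + (0 - 1) = -((k + 1 : ℕ) : ℤ)
    push_cast
    ring

theorem exists_word_r (n : ℤ) : ∃ ω, wordProd ω = .r (n : ZMod 0) := by
  obtain ⟨k, rfl | rfl⟩ := n.eq_nat_or_neg
  · exact exists_word_r_nat k
  · exact exists_word_r_neg k

theorem exists_word (w : AffineWeyl) : ∃ ω, wordProd ω = w := by
  rcases w with n | n
  · exact exists_word_r n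
  · obtain ⟨ω, hω⟩ := exists_word_r n
    refine ⟨[0] ++ ω, ?_⟩
    rw [wordProd_append, hω]
    simp [wordProd, gen]

/-- The length function: the least length of a word representing `w`. -/
def len (w : AffineWeyl) : ℕ := sInf {n | ∃ ω, ω.length = n ∧ wordProd ω = w}

theorem exists_reduced (w : AffineWeyl) : ∃ ω, ω.length = len w ∧ wordProd ω = w := by
  obtain ⟨ω, hω⟩ := exists_word w
  exact Nat.sInf_mem (s := {n | ∃ ω, ω.length = n ∧ wordProd ω = w}) ⟨_, ω, rfl, hω⟩

theorem len_wordProd_le (ω : List (Fin 2)) : len (wordProd ω) ≤ ω.length :=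
  Nat.sInf_le ⟨ω, rfl, rfl⟩

/-- The (unique) reduced word of `w`. -/
def redWord (w : AffineWeyl) : List (Fin 2) := (exists_reduced w).choose

theorem redWord_length (w : AffineWeyl) : (redWord w).length = len w :=
  (exists_reduced w).choose_spec.1

theorem wordProd_redWord (w : AffineWeyl) : wordProd (redWord w) = w :=
  (exists_reduced w).choose_spec.2

/-- The Bruhat interval `{y | y ≤ w}`: the elements represented by the words obtained from the
reduced word of `w` by deleting some letters. -/
def lower (w : AffineWeyl) : Finset AffineWeyl := ((redWord w).sublists.map wordProd).toFinset

theorem mem_lower {w y : AffineWeyl} :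
    y ∈ lower w ↔ ∃ ω, ω.Sublist (redWord w) ∧ wordProd ω = y := by
  simp [lower]

theorem self_mem_lower (w : AffineWeyl) : w ∈ lower w :=
  mem_lower.2 ⟨_, List.Sublist.refl _, wordProd_redWord w⟩

theorem len_lt_of_mem_lower {w y : AffineWeyl} (h : y ∈ lower w) (hne : y ≠ w) :
    len y < len w := by
  obtain ⟨ω, hω, rfl⟩ := mem_lower.1 h
  have h1 := len_wordProd_le ω
  have h2 := hω.length_le
  rw [redWord_length] at h2
  rcases (h1.trans h2).lt_or_eq with h3 | h3
  · exact h3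
  · exfalso
    apply hne
    rw [hω.eq_of_length (by rw [redWord_length]; omega), wordProd_redWord]

/-- `w` starts with `y`: a reduced expression of `y` followed by further letters is a reduced
expression of `w`. -/
def StartsWith (w y : AffineWeyl) : Prop := len w = len y + len (y⁻¹ * w)

/-! ### The Iwahori-Hecke algebra -/

/-- The ring `ℤ[q^{1/2}, q^{-1/2}]`; the variable `T` is `q^{1/2}`, so `q^{n/2}` is `T n`. -/
abbrev Coeff : Type := LaurentPolynomial ℤ

/-- `qHalf n = q^{n/2}`. -/
abbrev qHalf (n : ℤ) : Coeff := LaurentPolynomial.T n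

/-- The Iwahori-Hecke algebra `H`, free over `ℤ[q^{1/2}, q^{-1/2}]` on the basis
`T_w = single w 1`. -/
abbrev Hecke : Type := AffineWeyl →₀ Coeff

/-- Right multiplication by `T_s` for a simple reflection `s`: `T_w T_s = T_{ws}` if
`ℓ(ws) > ℓ(w)`, and `T_w T_s = (q - 1) T_w + q T_{ws}` otherwise. -/
def mulGen (s : Fin 2) : Hecke →ₗ[Coeff] Hecke :=
  Finsupp.linearCombination Coeff fun w =>
    if len w < len (w * gen s) then Finsupp.single (w * gen s) 1
    else Finsupp.single w (qHalf 2 - 1) + Finsupp.single (w * gen s) (qHalf 2)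

/-- The product of `H`: right multiplication by `T_y` is successive right multiplication by the
`T_s` along the reduced word of `y`. -/
def mul (a b : Hecke) : Hecke :=
  b.sum fun y c => c • (redWord y).foldl (fun h s => mulGen s h) a

/-- The Kazhdan-Lusztig element
`C_w = ∑_{y ≤ w} (-1)^{ℓ(w)-ℓ(y)} q^{(ℓ(w)-ℓ(y))/2} P_{y,w}(q⁻¹) q^{-ℓ(y)/2} T_y`,
where all the polynomials `P_{y,w}` with `y ≤ w` are equal to `1` for the infinite dihedral
group. -/
def klC (w : AffineWeyl) : Hecke :=
  ∑ y ∈ lower w, Finsupp.single y ((-1) ^ (len w - len y) * qHalf ((len w : ℤ) - 2 * len y))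

/-- The involution `j(∑ a_w T_w) = ∑ \bar{a_w} (-1)^{ℓ(w)} q^{-ℓ(w)} T_w`, where the bar is
`q^{1/2} ↦ q^{-1/2}`. -/
def jInv (a : Hecke) : Hecke :=
  a.sum fun w c =>
    Finsupp.single w (LaurentPolynomial.invert c * ((-1) ^ len w * qHalf (-2 * len w)))

/-- The Kazhdan-Lusztig element `C'_w = (-1)^{ℓ(w)} j(C_w)`. -/
def klC' (w : AffineWeyl) : Hecke := ((-1) ^ len w : Coeff) • jInv (klC w)

theorem klC_apply (w z : AffineWeyl) :
    klC w z = if z ∈ lower w then (-1) ^ (len w - len z) * qHalf ((len w : ℤ) - 2 * len z)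
      else 0 := by
  classical
  simp [klC, Finsupp.finsetSum_apply, Finsupp.single_apply]

theorem klC_self (w : AffineWeyl) : klC w w = qHalf (-(len w : ℤ)) := by
  rw [klC_apply, if_pos (self_mem_lower w)]
  simp only [Nat.sub_self, pow_zero, one_mul]
  congr 1
  ring

theorem klC_apply_eq_zero {w z : AffineWeyl} (h : len w ≤ len z) (hne : z ≠ w) :
    klC w z = 0 := by
  rw [klC_apply, if_neg]
  intro hz
  exact absurd (len_lt_of_mem_lower hz hne) (by omega)

theorem linearIndependent_klC : LinearIndependent Coeff klC := by
  rw [linearIndependent_iff]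
  intro l hl
  by_contra hne
  obtain ⟨w, hw, hmax⟩ := l.support.exists_max_image len (Finsupp.support_nonempty_iff.2 hne)
  have h := DFunLike.congr_fun hl w
  rw [Finsupp.linearCombination_apply, Finsupp.sum, Finsupp.finsetSum_apply,
    Finset.sum_eq_single w] at h
  · rw [Finsupp.smul_apply, klC_self, smul_eq_mul, Finsupp.zero_apply] at h
    have h2 : l w * qHalf (-(len w : ℤ)) * qHalf (len w : ℤ) = 0 := by rw [h, zero_mul]
    rw [mul_assoc, ← LaurentPolynomial.T_add, neg_add_cancel, LaurentPolynomial.T_zero,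
      mul_one] at h2
    exact Finsupp.mem_support_iff.1 hw h2
  · intro x hx hxw
    rw [Finsupp.smul_apply, klC_apply_eq_zero (hmax x hx) hxw.symm, smul_zero]
  · intro h'
    exact absurd hw h'

theorem single_mem_span_klC (n : ℕ) : ∀ w : AffineWeyl, len w = n →
    (Finsupp.single w 1 : Hecke) ∈ Submodule.span Coeff (Set.range klC) := by
  induction n using Nat.strong_induction_on with
  | _ n ih =>
    intro w hw
    have h1 : klC w = Finsupp.single w (qHalf (-(len w : ℤ))) +
        ∑ y ∈ (lower w).erase w,
          Finsupp.single y ((-1) ^ (len w - len y) * qHalf ((len w : ℤ) - 2 * len y)) := by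
      rw [klC, ← Finset.add_sum_erase _ _ (self_mem_lower w)]
      simp only [Nat.sub_self, pow_zero, one_mul]
      congr 3
      ring
    have h2 : (Finsupp.single w 1 : Hecke) = qHalf (len w : ℤ) • (klC w -
        ∑ y ∈ (lower w).erase w,
          ((-1) ^ (len w - len y) * qHalf ((len w : ℤ) - 2 * len y)) •
            (Finsupp.single y 1 : Hecke)) := by
      rw [h1]
      simp only [Finsupp.smul_single, smul_eq_mul, mul_one, add_sub_cancel_right]
      rw [← LaurentPolynomial.T_add, add_neg_cancel, LaurentPolynomial.T_zero]
    rw [h2]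
    refine Submodule.smul_mem _ _ (Submodule.sub_mem _ (Submodule.subset_span ⟨w, rfl⟩)
      (Submodule.sum_mem _ fun y hy => Submodule.smul_mem _ _ ?_))
    rw [Finset.mem_erase] at hy
    exact ih (len y) (hw ▸ len_lt_of_mem_lower hy.2 hy.1) y rfl

theorem span_klC : ⊤ ≤ Submodule.span Coeff (Set.range klC) := by
  intro a _
  rw [← Finsupp.sum_single a]
  refine Submodule.sum_mem _ fun w _ => ?_
  have : (Finsupp.single w (a w) : Hecke) = a w • Finsupp.single w 1 := by simp
  rw [this]
  exact Submodule.smul_mem _ _ (single_mem_span_klC _ w rfl)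

/-- The Kazhdan-Lusztig basis `{C_w}` of `H`. -/
def klBasis : Module.Basis AffineWeyl Coeff Hecke :=
  Module.Basis.mk linearIndependent_klC span_klC

/-- The structure constants `h_{x,y,z}`, defined by `C_x C_y = ∑_z h_{x,y,z} C_z`. -/
def structConst (x y z : AffineWeyl) : Coeff := klBasis.repr (mul (klC x) (klC y)) z

/-! ### The asymptotic Hecke algebra and the map `φ ∘ j` on completions -/

/-- Lusztig's `a`-function: the least `n` such that `(-q^{1/2})^n h_{x,y,z} ∈ ℤ[q^{1/2}]` for all
`x, y`. -/
def aFun (z : AffineWeyl) : ℕ :=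
  sInf {n | ∀ x y, ∀ k < 0, ((-qHalf 1) ^ n * structConst x y z).coeff k = 0}

/-- The distinguished involutions. -/
def distInv : Finset AffineWeyl := {1, gen 0, gen 1}

/-- A Laurent polynomial regarded as a formal Laurent series in the same variable. -/
def toSeries (c : Coeff) : LaurentSeries ℤ := HahnSeries.ofFinsupp c.coeff

/-- Families `(b_x)` of Laurent series with `b_x → 0`: for every `N`, the series `b_x` is divisible
by the `N`-th power of the variable as soon as `ℓ(x)` is large. Such families are the elements
`∑ b_x C_x` of the completion of `H` (variable `q^{1/2}`), and also the elements `∑ b_x C'_x` of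
the completion with respect to negative powers (variable `q^{-1/2}`). -/
def TendsToZero (b : AffineWeyl → LaurentSeries ℤ) : Prop :=
  ∀ N : ℤ, ∃ L : ℕ, ∀ x, L ≤ len x → ∀ k < N, (b x).coeff k = 0

/-- `φ (∑ b_x C_x) = ∑ b_x h_{x,d,z} t_z`, the sum being over `x, z` and over the distinguished
involutions `d` with `a(d) = a(z)`; elements of the completion of `J` are families of
coefficients with respect to `{t_z}`. -/
def phi (b : AffineWeyl → LaurentSeries ℤ) (z : AffineWeyl) : LaurentSeries ℤ :=
  ∑ᶠ x, ∑ d ∈ distInv with aFun d = aFun z, b x * toSeries (structConst x d z)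

/-- The extension of `j` to completions, from families of coefficients with respect to `{C'_x}` to
families of coefficients with respect to `{C_x}`:
`j (∑ a_x C'_x) = ∑ \bar{a_x} (-1)^{ℓ(x)} C_x`. The bar turns a series in `q^{-1/2}` into the
series in `q^{1/2}` with the same coefficients. -/
def jHat (a : AffineWeyl → LaurentSeries ℤ) (x : AffineWeyl) : LaurentSeries ℤ :=
  (-1) ^ len x * a x

/-- `a` is the family of coefficients, with respect to `{C'_x}`, of an element of the completion of
`H` whose image under `φ ∘ j` is the basis element `t_y` of `J`. -/
def IsPreimageT (y : AffineWeyl) (a : AffineWeyl → LaurentSeries ℤ) : Prop :=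
  TendsToZero a ∧ phi (jHat a) = Pi.single y 1

/-- The coefficient of `q^{-k/2}` in the coefficient of `T_w` in `∑ a_x C'_x`. The coefficient of
`T_w` in `C'_x` is expanded in the variable `q^{-1/2}`, hence the inversion. -/
def tCoeff (a : AffineWeyl → LaurentSeries ℤ) (w : AffineWeyl) (k : ℤ) : ℤ :=
  ∑ᶠ x, (a x * toSeries (LaurentPolynomial.invert (klC' x w))).coeff k

/-! ### The group `SL₂(F)` -/

variable {F : Type*} [Field F] [ValuativeRel F]

/-- A uniformizer of `F`. -/
def IsUniformizer (ϖ : Fˣ) : Prop :=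
  ∃ h : (ϖ : F) ∈ 𝒪[F], Irreducible (⟨(ϖ : F), h⟩ : 𝒪[F])

/-- `diag(u, u⁻¹)`. -/
def torus (u : Fˣ) : SL(2, F) := ⟨!![(u : F), 0; 0, ((u⁻¹ : Fˣ) : F)], by simp [det_fin_two]⟩

/-- The standard representative of the nontrivial element of the finite Weyl group. -/
def weylElt : SL(2, F) := ⟨!![0, -1; 1, 0], by simp [det_fin_two]⟩

/-- A representative in `SL₂(F)` of an element of the affine Weyl group. -/
def lift (ϖ : Fˣ) : AffineWeyl → SL(2, F)
  | .r n => torus (ϖ ^ (show ℤ from n))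
  | .sr n => weylElt * torus (ϖ ^ (show ℤ from n))

variable (F) in
/-- The maximal compact subgroup `K = SL₂(𝒪)`. -/
def maxCompact : Subgroup SL(2, F) :=
  (SpecialLinearGroup.map (n := Fin 2) (algebraMap 𝒪[F] F)).range

variable (F) in
/-- The Iwahori subgroup: the matrices of `SL₂(𝒪)` that are upper triangular modulo the maximal
ideal. -/
def iwahori : Subgroup SL(2, F) :=
  Subgroup.map (SpecialLinearGroup.map (n := Fin 2) (algebraMap 𝒪[F] F))
    { carrier := {g | g 1 0 ∈ 𝓂[F]}
      one_mem' := by simp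
      mul_mem' := by
        intro g h hg hh
        have e : (g * h) 1 0 = g 1 0 * h 0 0 + g 1 1 * h 1 0 :=
          (Matrix.mul_apply (M := g.1) (N := h.1) (i := 1) (k := 0)).trans (Fin.sum_univ_two _)
        rw [Set.mem_ofPred_eq] at hg hh ⊢
        rw [e]
        exact Ideal.add_mem _ (Ideal.mul_mem_right _ _ hg) (Ideal.mul_mem_left _ _ hh)
      inv_mem' := by
        intro g hg
        rw [Set.mem_ofPred_eq] at hg ⊢
        rw [SpecialLinearGroup.SL2_inv_expl]
        simpa using hg }

/-- The double coset `I w I`, whose characteristic function is `T_w`. -/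
def iwahoriCell (ϖ : Fˣ) (w : AffineWeyl) : Set SL(2, F) :=
  DoubleCoset.doubleCoset (lift ϖ w) (iwahori F) (iwahori F)

variable [TopologicalSpace F] [IsNonarchimedeanLocalField F]

variable (F) in
/-- The cardinality `q` of the residue field. -/
def resCard : ℕ := Nat.card 𝓀[F]

open scoped Classical in
/-- The normalized absolute value of `F`. -/
def absF (x : F) : ℝ :=
  if x = 0 then 0
  else (resCard F : ℝ) ^
    (WithZero.log (IsNonarchimedeanLocalField.valueGroupWithZeroIsoInt F (valuation F x)))

/-- `λ(g)`: the natural number `n` with `g ∈ K diag(ϖ^n, ϖ^{-n}) K`. -/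
def cartan (ϖ : Fˣ) (g : SL(2, F)) : ℕ :=
  sInf {n | g ∈ DoubleCoset.doubleCoset (torus (ϖ ^ n)) (maxCompact F : Set SL(2, F))
    (maxCompact F)}

/-- `Δ(g) = q^{⟨λ(g), ρ⟩}`, where `⟨n α^∨, ρ⟩ = n`. -/
def cartanDelta (ϖ : Fˣ) (g : SL(2, F)) : ℝ := (resCard F : ℝ) ^ cartan ϖ g

/-- The value at `g` of the polynomial function on `SL₂` given by a polynomial in the matrix
entries. -/
def polyFun (p : MvPolynomial (Fin 2 × Fin 2) F) (g : SL(2, F)) : F :=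
  MvPolynomial.eval (fun ij => g ij.1 ij.2) p

/-- `f` lies in the Harish-Chandra Schwartz space of `SL₂(F)`. The inequality
`Δ(g) |f(g)| ≤ C / (log (1 + |p(g)|))^m` is written without denominators, so that it is no
condition where `p(g) = 0`. -/
def IsSchwartz (ϖ : Fˣ) (f : SL(2, F) → ℂ) : Prop :=
  (∃ U : Subgroup SL(2, F), IsOpen (U : Set SL(2, F)) ∧ IsCompact (U : Set SL(2, F)) ∧
    ∀ u ∈ U, ∀ v ∈ U, ∀ g, f (u * g * v) = f g) ∧
  ∀ (p : MvPolynomial (Fin 2 × Fin 2) F) (m : ℝ), 0 < m → ∃ C : ℝ, ∀ g : SL(2, F),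
    cartanDelta ϖ g * ‖f g‖ * Real.log (1 + absF (polyFun p g)) ^ m ≤ C

/-- `f` is the function on `SL₂(F)` represented by `∑ a_x C'_x`: on each `I w I` it is constant,
with value the coefficient of `T_w`, a series in `q^{-1/2}`, evaluated at the cardinality `q` of
the residue field. -/
def Represents (ϖ : Fˣ) (a : AffineWeyl → LaurentSeries ℤ) (f : SL(2, F) → ℂ) : Prop :=
  ∀ w, ∀ g ∈ iwahoriCell ϖ w,
    HasSum (fun k : ℤ => (tCoeff a w k : ℂ) * (((Real.sqrt (resCard F))⁻¹ : ℝ) : ℂ) ^ k) (f g)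

open scoped Classical in
/-- The explicit coefficient of `T_w` in `t_y`, for `y ≠ 1`; here `y_k` is the product of the first
`k` letters of the reduced word of `y`. -/
def explicitCoeff (q : ℝ) (y w : AffineWeyl) : ℝ :=
  -(Real.sqrt q) ^ (len y - 1) * ∑ k ∈ Finset.Icc 1 (len y), q ^ ((k : ℤ) - len y) *
    (if StartsWith w (wordProd ((redWord y).take k)) then
      (-1) ^ len w * q ^ (-(len w : ℤ) + 1) / (1 + q)
    else if k ≤ len w then (-1) ^ (len w + 1) * q ^ (-(len w : ℤ)) / (1 + q)
    else (-1) ^ k * q ^ (-(k : ℤ) + 1) / (1 + q))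

end AsymptoticHecke

end

/-!
The alcove coordinate identifies the affine Weyl group with `ℤ`, so that right multiplication by a
simple reflection is a step to a neighbour. With `v = q^{-1/2}`, the rule for `C_x C_s` shows that
`a` takes only the values `0` (at `1`) and `1`, and that along each of the two rays starting at `1`
the map `φ ∘ j` is the second-order difference operator
`b_{n+2} + b_n - (v + v⁻¹) b_{n+1}`. Its characteristic roots are `v` and `v⁻¹`, and no nonzero
solution vanishing at `0` tends to zero; hence `t_y` has at most one preimage.

A preimage is a telescoping combination of the families `(-1)^{ℓ(x)} v^{ℓ(x) + c}` supported on the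
elements `x` starting with `y_k`. As `C'_x = v^{ℓ(x)} ∑_{w ≤ x} T_w`, the coefficient of `T_w` is a
sum of geometric series, which gives the explicit formula and the bound `O(q^{-ℓ(w)})`.

On `I w I` one has `Δ = q^n` with `2n ≤ ℓ(w) + 1`, and `log (1 + |p|)` grows at most linearly in
`n`. Thus `Δ |f| (log (1 + |p|))^m` is at most a constant times `q^{-n}` times a power of `1 + n`.
-/

noncomputable section

namespace AsymptoticHecke

/-! ### Alcoves on the line -/

/-- The alcove coordinate. It identifies the affine Weyl group with `ℤ` in such a way that the
length is the distance to `0`, right multiplication by a simple reflection is a step to a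
neighbour, and the reduced words starting with `s₀` are on the positive side. -/
def pos : AffineWeyl → ℤ
  | .r n => 2 * (show ℤ from n)
  | .sr n => 1 - 2 * (show ℤ from n)

theorem pos_r (n : ℤ) : pos (.r n) = 2 * n := rfl

theorem pos_sr (n : ℤ) : pos (.sr n) = 1 - 2 * n := rfl

theorem exists_eq_r_or_sr (w : AffineWeyl) : (∃ n : ℤ, w = .r n) ∨ ∃ n : ℤ, w = .sr n := by
  rcases w with n | n
  exacts [.inl ⟨n, rfl⟩, .inr ⟨n, rfl⟩]

/-- The element of the affine Weyl group with a given alcove coordinate. -/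
def ofPos (k : ℤ) : AffineWeyl :=
  if k % 2 = 0 then .r (show ℤ from k / 2) else .sr (show ℤ from (1 - k) / 2)

@[simp] theorem pos_ofPos (k : ℤ) : pos (ofPos k) = k := by
  unfold ofPos
  split_ifs with h
  · exact (pos_r (k / 2)).trans (by omega)
  · exact (pos_sr ((1 - k) / 2)).trans (by omega)

theorem pos_injective : Function.Injective pos := by
  intro x y h
  obtain ⟨m, rfl⟩ | ⟨m, rfl⟩ := exists_eq_r_or_sr x <;>
    obtain ⟨n, rfl⟩ | ⟨n, rfl⟩ := exists_eq_r_or_sr y <;>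
    simp only [pos_r, pos_sr] at h
  · exact congrArg (fun k : ℤ => (DihedralGroup.r k : AffineWeyl)) (by omega)
  · omega
  · omega
  · exact congrArg (fun k : ℤ => (DihedralGroup.sr k : AffineWeyl)) (by omega)

theorem pos_mul (x y : AffineWeyl) :
    pos (x * y) = if pos x % 2 = 0 then pos x + pos y else pos x - pos y := by
  obtain ⟨m, rfl⟩ | ⟨m, rfl⟩ := exists_eq_r_or_sr x <;>
    obtain ⟨n, rfl⟩ | ⟨n, rfl⟩ := exists_eq_r_or_sr y
  · refine (pos_r (m + n)).trans ?_
    rw [pos_r, pos_r, if_pos (by omega)]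
    ring
  · refine (pos_sr (n - m)).trans ?_
    rw [pos_r, pos_sr, if_pos (by omega)]
    ring
  · refine (pos_sr (m + n)).trans ?_
    rw [pos_sr, pos_r, if_neg (by omega)]
    ring
  · refine (pos_r (n - m)).trans ?_
    rw [pos_sr, pos_sr, if_neg (by omega)]
    ring

@[simp] theorem pos_one : pos 1 = 0 := rfl

theorem pos_gen (s : Fin 2) : pos (gen s) = 1 - 2 * (s : ℕ) := by
  fin_cases s <;> rfl

theorem pos_eq_zero {w : AffineWeyl} : pos w = 0 ↔ w = 1 :=
  ⟨fun h => pos_injective h, fun h => h ▸ rfl⟩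

theorem pos_inv (x : AffineWeyl) : pos x⁻¹ = if pos x % 2 = 0 then -pos x else pos x := by
  have h := pos_mul x x⁻¹
  rw [mul_inv_cancel, pos_one] at h
  split_ifs at h ⊢ <;> omega

theorem natAbs_pos_inv_mul (x y : AffineWeyl) :
    (pos (x⁻¹ * y)).natAbs = (pos y - pos x).natAbs := by
  have h₁ := pos_mul x⁻¹ y
  have h₂ := pos_inv x
  split_ifs at h₁ h₂ <;> omega

theorem pos_mul_gen (w : AffineWeyl) (s : Fin 2) :
    pos (w * gen s) = if (pos w + (s : ℕ)) % 2 = 0 then pos w + 1 else pos w - 1 := by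
  rw [pos_mul, pos_gen]
  fin_cases s <;> split_ifs <;> omega

theorem pos_mul_gen_add_one (w : AffineWeyl) (s : Fin 2) :
    pos (w * gen (s + 1)) = 2 * pos w - pos (w * gen s) := by
  rw [pos_mul_gen, pos_mul_gen]
  fin_cases s <;>
    simp only [Fin.zero_eta, Fin.mk_one, Fin.val_zero, Fin.val_one, zero_add, Fin.reduceAdd] <;>
    split_ifs <;> omega

@[simp] theorem mul_gen_mul_gen (w : AffineWeyl) (s : Fin 2) : w * gen s * gen s = w := by
  apply pos_injective
  rw [pos_mul_gen, pos_mul_gen]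
  split_ifs <;> omega

/-! ### Length, descents and the Bruhat order -/

theorem wordProd_append_singleton (ω : List (Fin 2)) (s : Fin 2) :
    wordProd (ω ++ [s]) = wordProd ω * gen s := by
  simp [wordProd]

theorem natAbs_pos_mul_wordProd_sub_le (w : AffineWeyl) (ω : List (Fin 2)) :
    (pos (w * wordProd ω) - pos w).natAbs ≤ ω.length := by
  induction ω generalizing w with
  | nil => simp [wordProd]
  | cons s ω ih =>
    have hstep := pos_mul_gen w s
    have htail := ih (w * gen s)
    rw [mul_assoc, show gen s * wordProd ω = wordProd (s :: ω) by simp [wordProd]] at htail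
    rw [List.length_cons]
    split_ifs at hstep <;> omega

theorem exists_natAbs_pos_mul_gen_add_one {w : AffineWeyl} (hw : w ≠ 1) :
    ∃ s, (pos (w * gen s)).natAbs + 1 = (pos w).natAbs := by
  have hw' := mt pos_eq_zero.1 hw
  have h₀ := pos_mul_gen w 0
  have h₁ := pos_mul_gen_add_one w 0
  by_cases h : (pos (w * gen 0)).natAbs + 1 = (pos w).natAbs
  · exact ⟨0, h⟩
  · refine ⟨0 + 1, ?_⟩
    split_ifs at h₀ <;> omega

theorem exists_word_length_eq_natAbs_pos (w : AffineWeyl) :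
    ∃ ω, ω.length = (pos w).natAbs ∧ wordProd ω = w := by
  induction h : (pos w).natAbs generalizing w with
  | zero => exact ⟨[], rfl, (pos_eq_zero.1 (by omega)).symm⟩
  | succ n ih =>
    obtain ⟨s, hs⟩ := exists_natAbs_pos_mul_gen_add_one (w := w) (by rintro rfl; simp at h)
    obtain ⟨ω, hlen, hprod⟩ := ih (w * gen s) (by omega)
    refine ⟨ω ++ [s], by simp [hlen], ?_⟩
    rw [wordProd_append_singleton, hprod, mul_gen_mul_gen]

theorem len_eq_natAbs_pos (w : AffineWeyl) : len w = (pos w).natAbs := by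
  apply le_antisymm
  · obtain ⟨ω, hlen, hprod⟩ := exists_word_length_eq_natAbs_pos w
    simpa only [hprod, hlen] using len_wordProd_le ω
  · obtain ⟨ω, hlen, hprod⟩ := exists_reduced w
    simpa [hlen, hprod] using natAbs_pos_mul_wordProd_sub_le 1 ω

@[simp] theorem len_one : len 1 = 0 := by simp [len_eq_natAbs_pos]

theorem len_eq_zero {w : AffineWeyl} : len w = 0 ↔ w = 1 := by
  rw [len_eq_natAbs_pos, Int.natAbs_eq_zero, pos_eq_zero]

theorem len_gen (s : Fin 2) : len (gen s) = 1 := by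
  rw [len_eq_natAbs_pos, pos_gen]
  fin_cases s <;> rfl

theorem gen_ne_one (s : Fin 2) : gen s ≠ 1 := by
  rw [← len_eq_zero.ne, len_gen]
  exact one_ne_zero

/-- `s` is a right descent of `w`: the reduced word of `w` ends with `s`. -/
def IsRightDescent (w : AffineWeyl) (s : Fin 2) : Prop := len (w * gen s) < len w

theorem isRightDescent_iff {w : AffineWeyl} {s : Fin 2} :
    IsRightDescent w s ↔ len (w * gen s) + 1 = len w := by
  rw [IsRightDescent, len_eq_natAbs_pos, len_eq_natAbs_pos, pos_mul_gen]
  split_ifs <;> omega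

theorem not_isRightDescent_iff {w : AffineWeyl} {s : Fin 2} :
    ¬IsRightDescent w s ↔ len (w * gen s) = len w + 1 := by
  rw [IsRightDescent, len_eq_natAbs_pos, len_eq_natAbs_pos, pos_mul_gen]
  split_ifs <;> omega

theorem len_lt_len_mul_gen_iff {w : AffineWeyl} {s : Fin 2} :
    len w < len (w * gen s) ↔ ¬IsRightDescent w s := by
  rw [IsRightDescent, len_eq_natAbs_pos, len_eq_natAbs_pos, pos_mul_gen]
  split_ifs <;> omega

theorem isRightDescent_mul_gen {w : AffineWeyl} {s : Fin 2} :
    IsRightDescent (w * gen s) s ↔ ¬IsRightDescent w s := by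
  rw [isRightDescent_iff, not_isRightDescent_iff, mul_gen_mul_gen]
  exact eq_comm

theorem not_isRightDescent_one (s : Fin 2) : ¬IsRightDescent 1 s := by
  simp [IsRightDescent]

theorem isRightDescent_gen (s : Fin 2) : IsRightDescent (gen s) s := by
  simpa using isRightDescent_mul_gen.2 (not_isRightDescent_one s)

theorem exists_isRightDescent {w : AffineWeyl} (hw : w ≠ 1) : ∃ s, IsRightDescent w s := by
  obtain ⟨s, hs⟩ := exists_natAbs_pos_mul_gen_add_one hw
  exact ⟨s, isRightDescent_iff.2 (by simpa only [len_eq_natAbs_pos] using hs)⟩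

theorem isRightDescent_add_one_iff {w : AffineWeyl} {s : Fin 2} (hw : w ≠ 1) :
    IsRightDescent w (s + 1) ↔ ¬IsRightDescent w s := by
  have hpos := mt pos_eq_zero.1 hw
  rw [IsRightDescent, IsRightDescent, len_eq_natAbs_pos, len_eq_natAbs_pos, len_eq_natAbs_pos,
    pos_mul_gen_add_one, pos_mul_gen]
  split_ifs <;> omega

theorem IsRightDescent.ne_one {w : AffineWeyl} {s : Fin 2} (hs : IsRightDescent w s) : w ≠ 1 := by
  rintro rfl
  exact not_isRightDescent_one s hs

theorem IsRightDescent.not_add_one {w : AffineWeyl} {s : Fin 2} (hs : IsRightDescent w s) :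
    ¬IsRightDescent w (s + 1) := by
  rwa [isRightDescent_add_one_iff hs.ne_one, not_not]

theorem IsRightDescent.unique {w : AffineWeyl} {s t : Fin 2} (hs : IsRightDescent w s)
    (ht : IsRightDescent w t) : s = t := by
  rw [IsRightDescent, len_eq_natAbs_pos, len_eq_natAbs_pos, pos_mul_gen] at hs ht
  split_ifs at hs ht <;> omega

theorem eq_of_len_eq_of_isRightDescent_iff {x z : AffineWeyl} {s : Fin 2} (hlen : len x = len z)
    (hs : IsRightDescent x s ↔ IsRightDescent z s) : x = z := by
  apply pos_injective
  simp only [IsRightDescent, len_eq_natAbs_pos, pos_mul_gen] at hs hlen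
  split_ifs at hs <;> omega

theorem length_eq_len_of_append_singleton {ω : List (Fin 2)} {s : Fin 2}
    (h : (ω ++ [s]).length = len (wordProd (ω ++ [s]))) :
    ω.length = len (wordProd ω) ∧ IsRightDescent (wordProd (ω ++ [s])) s := by
  have hle := len_wordProd_le ω
  rw [wordProd_append_singleton, List.length_append, List.length_singleton] at h
  rw [wordProd_append_singleton, isRightDescent_mul_gen, not_isRightDescent_iff]
  rcases em (IsRightDescent (wordProd ω) s) with hs | hs
  · rw [isRightDescent_iff] at hs
    omega
  · rw [not_isRightDescent_iff] at hs
    omega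

theorem eq_redWord {ω : List (Fin 2)} (h : ω.length = len (wordProd ω)) :
    ω = redWord (wordProd ω) := by
  suffices ∀ ω', wordProd ω' = wordProd ω → ω'.length = len (wordProd ω') → ω = ω' from
    this _ (wordProd_redWord _) (by rw [wordProd_redWord, redWord_length])
  induction ω using List.reverseRecOn with
  | nil =>
    intro ω' hprod hlen
    rw [hprod, ← h, List.length_nil] at hlen
    exact (List.length_eq_zero_iff.1 hlen).symm
  | append_singleton ω s ih =>
    intro ω' hprod hlen
    induction ω' using List.reverseRecOn with
    | nil =>
      rw [← hprod, ← hlen] at h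
      simp at h
    | append_singleton ω' t _ =>
      obtain ⟨hω, hs⟩ := length_eq_len_of_append_singleton h
      obtain ⟨hω', ht⟩ := length_eq_len_of_append_singleton hlen
      rw [hprod] at ht
      obtain rfl := hs.unique ht
      simp only [wordProd_append_singleton, mul_left_inj] at hprod
      rw [ih hω ω' hprod hω']

theorem redWord_mul_gen {w : AffineWeyl} {s : Fin 2} (hs : ¬IsRightDescent w s) :
    redWord (w * gen s) = redWord w ++ [s] := by
  have hprod : wordProd (redWord w ++ [s]) = w * gen s := by
    rw [wordProd_append_singleton, wordProd_redWord]
  rw [← hprod, ← eq_redWord]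
  rw [hprod, not_isRightDescent_iff.1 hs, List.length_append, redWord_length, List.length_singleton]

@[simp] theorem redWord_one : redWord 1 = [] := by
  rw [← List.length_eq_zero_iff, redWord_length, len_one]

@[simp] theorem redWord_gen (s : Fin 2) : redWord (gen s) = [s] := by
  simpa using redWord_mul_gen (not_isRightDescent_one s)

theorem lower_subset_lower_mul_gen {w : AffineWeyl} {s : Fin 2} (hs : ¬IsRightDescent w s) :
    lower w ⊆ lower (w * gen s) := by
  intro y hy
  obtain ⟨ω, hω, hprod⟩ := mem_lower.1 hy
  refine mem_lower.2 ⟨ω, ?_, hprod⟩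
  rw [redWord_mul_gen hs]
  exact hω.trans (List.sublist_append_left _ _)

theorem mul_gen_mem_lower_mul_gen {w y : AffineWeyl} {s : Fin 2} (hs : ¬IsRightDescent w s)
    (hy : y ∈ lower w) : y * gen s ∈ lower (w * gen s) := by
  obtain ⟨ω, hω, hprod⟩ := mem_lower.1 hy
  refine mem_lower.2 ⟨ω ++ [s], ?_, by rw [wordProd_append_singleton, hprod]⟩
  rw [redWord_mul_gen hs]
  exact hω.append (List.Sublist.refl _)

theorem mem_lower_iff {w y : AffineWeyl} : y ∈ lower w ↔ len y < len w ∨ y = w := by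
  refine ⟨fun h => (em (y = w)).symm.imp_left (len_lt_of_mem_lower h), ?_⟩
  rintro (hlen | rfl)
  swap
  · exact self_mem_lower y
  induction h : len w generalizing w y with
  | zero => omega
  | succ n ih =>
    obtain ⟨s, hs⟩ := exists_isRightDescent (w := w) (by rintro rfl; simp at h)
    obtain ⟨x, rfl⟩ : ∃ x, w = x * gen s := ⟨w * gen s, by simp⟩
    rw [isRightDescent_mul_gen] at hs
    have hx := not_isRightDescent_iff.1 hs
    rcases lt_or_ge (len y) (len x) with hyx | hxy
    · exact lower_subset_lower_mul_gen hs (ih hyx (by omega))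
    by_cases hys : IsRightDescent y s
    · rw [isRightDescent_iff] at hys
      simpa using mul_gen_mem_lower_mul_gen hs (ih (y := y * gen s) (w := x) (by omega) (by omega))
    · obtain rfl : y = x := eq_of_len_eq_of_isRightDescent_iff (by omega) (iff_of_false hys hs)
      exact lower_subset_lower_mul_gen hs (self_mem_lower y)

theorem mem_lower_iff_len_le {w z : AffineWeyl} {s : Fin 2}
    (hs : IsRightDescent w s ↔ IsRightDescent z s) : z ∈ lower w ↔ len z ≤ len w := by
  rw [mem_lower_iff, le_iff_lt_or_eq]
  exact or_congr_right
    ⟨fun h => h ▸ rfl, fun h => eq_of_len_eq_of_isRightDescent_iff h hs.symm⟩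

theorem mem_lower_iff_len_lt {w z : AffineWeyl} (hne : z ≠ w) :
    z ∈ lower w ↔ len z < len w := by
  rw [mem_lower_iff, or_iff_left hne]

/-! ### Rays -/

theorem startsWith_iff {w y : AffineWeyl} :
    StartsWith w y ↔ (0 ≤ pos y ∧ pos y ≤ pos w) ∨ (pos y ≤ 0 ∧ pos w ≤ pos y) := by
  rw [StartsWith, len_eq_natAbs_pos, len_eq_natAbs_pos, len_eq_natAbs_pos, natAbs_pos_inv_mul]
  omega

/-- The element of length `n` whose reduced word starts with `s₀` (if `σ = 1`) or with `s₁`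
(if `σ = -1`). -/
def ray (σ : ℤˣ) (n : ℕ) : AffineWeyl := ofPos (σ * n)

/-- The side of `1` on which `w` lies; for `w = 1` the choice does not matter. -/
def direction (w : AffineWeyl) : ℤˣ := if 0 ≤ pos w then 1 else -1

@[simp] theorem pos_ray (σ : ℤˣ) (n : ℕ) : pos (ray σ n) = σ * n := pos_ofPos _

@[simp] theorem len_ray (σ : ℤˣ) (n : ℕ) : len (ray σ n) = n := by
  obtain rfl | rfl := Int.units_eq_one_or σ <;> simp [len_eq_natAbs_pos]

@[simp] theorem ray_zero (σ : ℤˣ) : ray σ 0 = 1 := pos_injective (by simp)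

@[simp] theorem ray_direction_len (w : AffineWeyl) : ray (direction w) (len w) = w := by
  apply pos_injective
  rw [pos_ray, direction, len_eq_natAbs_pos]
  split_ifs
  · rw [Units.val_one]
    omega
  · rw [Units.val_neg, Units.val_one]
    omega

theorem ray_ne_one {σ : ℤˣ} {n : ℕ} (hn : 1 ≤ n) : ray σ n ≠ 1 := by
  rw [← len_eq_zero.ne, len_ray]
  omega

theorem eq_one_or_exists_eq_ray (w : AffineWeyl) : w = 1 ∨ ∃ σ n, w = ray σ (n + 1) := by
  refine or_iff_not_imp_left.2 fun hw => ⟨direction w, len w - 1, ?_⟩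
  rw [Nat.sub_add_cancel (Nat.one_le_iff_ne_zero.2 (len_eq_zero.not.2 hw)), ray_direction_len]

theorem ray_eq_ray_iff {σ τ : ℤˣ} {k m : ℕ} (hk : 1 ≤ k) :
    ray τ m = ray σ k ↔ τ = σ ∧ m = k := by
  rw [← pos_injective.eq_iff, pos_ray, pos_ray]
  obtain rfl | rfl := Int.units_eq_one_or σ <;> obtain rfl | rfl := Int.units_eq_one_or τ <;>
    simp <;> omega

theorem startsWith_one_right (w : AffineWeyl) : StartsWith w 1 := by simp [StartsWith]

theorem startsWith_ray_iff {w : AffineWeyl} {σ : ℤˣ} {k : ℕ} (hk : 1 ≤ k) :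
    StartsWith w (ray σ k) ↔ (k : ℤ) ≤ σ * pos w := by
  rw [startsWith_iff, pos_ray]
  obtain rfl | rfl := Int.units_eq_one_or σ
  · rw [Units.val_one]
    omega
  · rw [Units.val_neg, Units.val_one]
    omega

theorem startsWith_ray_ray_iff {σ τ : ℤˣ} {k m : ℕ} (hk : 1 ≤ k) :
    StartsWith (ray τ m) (ray σ k) ↔ τ = σ ∧ k ≤ m := by
  rw [startsWith_ray_iff hk, pos_ray]
  obtain rfl | rfl := Int.units_eq_one_or σ <;> obtain rfl | rfl := Int.units_eq_one_or τ <;>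
    simp <;> omega

theorem wordProd_take_redWord {y : AffineWeyl} {k : ℕ} (hk : k ≤ len y) :
    wordProd ((redWord y).take k) = ray (direction y) k := by
  have htake := natAbs_pos_mul_wordProd_sub_le 1 ((redWord y).take k)
  have hdrop := natAbs_pos_mul_wordProd_sub_le (wordProd ((redWord y).take k)) ((redWord y).drop k)
  rw [← wordProd_append, List.take_append_drop, wordProd_redWord, List.length_drop,
    redWord_length] at hdrop
  rw [one_mul, List.length_take, redWord_length, pos_one] at htake
  apply pos_injective
  rw [pos_ray, direction]
  rw [len_eq_natAbs_pos] at *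
  split_ifs
  · rw [Units.val_one]
    omega
  · rw [Units.val_neg, Units.val_one]
    omega

theorem ray_mul_gen_of_isRightDescent {σ : ℤˣ} {n : ℕ} {s : Fin 2}
    (hs : IsRightDescent (ray σ (n + 1)) s) : ray σ (n + 1) * gen s = ray σ n := by
  rw [isRightDescent_iff, len_eq_natAbs_pos, len_ray] at hs
  have hstep := pos_mul_gen (ray σ (n + 1)) s
  apply pos_injective
  rw [pos_ray] at hstep ⊢
  obtain rfl | rfl := Int.units_eq_one_or σ <;>
    simp only [Units.val_one, Units.val_neg] at hstep ⊢ <;> split_ifs at hstep <;> omega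

theorem ray_mul_gen_of_not_isRightDescent {σ : ℤˣ} {n : ℕ} {s : Fin 2}
    (hs : ¬IsRightDescent (ray σ (n + 1)) s) : ray σ (n + 1) * gen s = ray σ (n + 2) := by
  rw [not_isRightDescent_iff, len_eq_natAbs_pos, len_ray] at hs
  have hstep := pos_mul_gen (ray σ (n + 1)) s
  apply pos_injective
  rw [pos_ray] at hstep ⊢
  obtain rfl | rfl := Int.units_eq_one_or σ <;>
    simp only [Units.val_one, Units.val_neg] at hstep ⊢ <;> split_ifs at hstep <;> omega

theorem isRightDescent_ray_add_two {σ : ℤˣ} {n : ℕ} {s : Fin 2} :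
    IsRightDescent (ray σ (n + 2)) s ↔ ¬IsRightDescent (ray σ (n + 1)) s := by
  constructor
  · intro h
    rw [← ray_mul_gen_of_isRightDescent h, isRightDescent_mul_gen, not_not]
    exact h
  · intro h
    rw [← ray_mul_gen_of_not_isRightDescent h, isRightDescent_mul_gen]
    exact h

theorem exists_gen_eq_ray_one (σ : ℤˣ) : ∃ s, gen s = ray σ 1 := by
  obtain ⟨s, hs⟩ := exists_isRightDescent (ray_ne_one (σ := σ) le_rfl)
  refine ⟨s, ?_⟩
  rw [← mul_gen_mul_gen (ray σ 1) s, ray_mul_gen_of_isRightDescent hs, ray_zero, one_mul]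

/-! ### Right multiplication by `C_s` -/

instance (w : AffineWeyl) (s : Fin 2) : Decidable (IsRightDescent w s) :=
  inferInstanceAs (Decidable (_ < _))

theorem qHalf_mul_qHalf (m n : ℤ) : qHalf m * qHalf n = qHalf (m + n) :=
  (LaurentPolynomial.T_add m n).symm

theorem mulGen_single (s : Fin 2) (w : AffineWeyl) (c : Coeff) :
    mulGen s (Finsupp.single w c) =
      if IsRightDescent w s then
        Finsupp.single w (c * (qHalf 2 - 1)) + Finsupp.single (w * gen s) (c * qHalf 2)
      else Finsupp.single (w * gen s) c := by
  rw [mulGen, Finsupp.linearCombination_single, if_congr len_lt_len_mul_gen_iff rfl rfl,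
    ite_not]
  split_ifs
  · rw [smul_add, Finsupp.smul_single, Finsupp.smul_single, smul_eq_mul, smul_eq_mul]
  · rw [Finsupp.smul_single, smul_eq_mul, mul_one]

theorem mulGen_apply (s : Fin 2) (a : Hecke) (z : AffineWeyl) :
    mulGen s a z =
      if IsRightDescent z s then a (z * gen s) + (qHalf 2 - 1) * a z
      else qHalf 2 * a (z * gen s) := by
  classical
  induction a using Finsupp.induction_linear with
  | zero => simp
  | add f g hf hg =>
    rw [map_add, Finsupp.add_apply, hf, hg]
    split_ifs <;> simp only [Finsupp.add_apply] <;> ring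
  | single w c =>
    have hself : w ≠ w * gen s := by simp [gen_ne_one]
    rw [mulGen_single]
    by_cases hz : w = z
    · subst hz
      split_ifs <;> simp [hself, hself.symm, mul_comm]
    · by_cases hzs : w = z * gen s
      · subst hzs
        simp only [isRightDescent_mul_gen, mul_gen_mul_gen]
        split_ifs <;> simp [hz, mul_comm]
      · have hzs' : w * gen s ≠ z := fun h => hzs (by rw [← h, mul_gen_mul_gen])
        split_ifs <;> simp [hz, hzs, hzs']

theorem mulGen_mulGen (s : Fin 2) (a : Hecke) :
    mulGen s (mulGen s a) = (qHalf 2 - 1) • mulGen s a + qHalf 2 • a := by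
  ext1 z
  by_cases hz : IsRightDescent z s <;>
    simp only [mulGen_apply, isRightDescent_mul_gen, mul_gen_mul_gen, hz, Finsupp.add_apply,
      Finsupp.smul_apply, smul_eq_mul, not_true_eq_false, not_false_eq_true, if_true, if_false] <;>
    ring

/-- Left multiplication by an element of the Hecke algebra, as a linear map. -/
def mulLeft (a : Hecke) : Hecke →ₗ[Coeff] Hecke :=
  Finsupp.linearCombination Coeff fun y => (redWord y).foldl (fun h s => mulGen s h) a

theorem mul_eq_mulLeft (a b : Hecke) : mul a b = mulLeft a b := rfl

theorem mulLeft_single (a : Hecke) (y : AffineWeyl) (c : Coeff) :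
    mulLeft a (Finsupp.single y c) = c • (redWord y).foldl (fun h s => mulGen s h) a := by
  rw [mulLeft, Finsupp.linearCombination_single]

theorem mulLeft_single_mul_gen (a : Hecke) {y : AffineWeyl} {s : Fin 2}
    (hs : ¬IsRightDescent y s) (c : Coeff) :
    mulLeft a (Finsupp.single (y * gen s) c) = mulGen s (mulLeft a (Finsupp.single y c)) := by
  rw [mulLeft_single, mulLeft_single, redWord_mul_gen hs, List.foldl_append, map_smul,
    List.foldl_cons, List.foldl_nil]

theorem mulLeft_mulGen (s : Fin 2) (a b : Hecke) :
    mulLeft a (mulGen s b) = mulGen s (mulLeft a b) := by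
  induction b using Finsupp.induction_linear with
  | zero => simp
  | add f g hf hg => simp only [map_add, hf, hg]
  | single w c =>
    rw [mulGen_single]
    split_ifs with hs
    · obtain ⟨x, rfl⟩ : ∃ x, w = x * gen s := ⟨w * gen s, by simp⟩
      rw [isRightDescent_mul_gen] at hs
      have hsmul (e : Coeff) (z : AffineWeyl) :
          (Finsupp.single z (c * e) : Hecke) = e • Finsupp.single z c := by
        rw [Finsupp.smul_single, smul_eq_mul, mul_comm]
      rw [hsmul, hsmul, mul_gen_mul_gen, map_add, map_smul, map_smul,
        mulLeft_single_mul_gen a hs, mulGen_mulGen]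
    · exact mulLeft_single_mul_gen a hs c

/-- Right multiplication by `C_s = q^{-1/2} T_s - q^{1/2}` for a simple reflection `s`. -/
def mulC (s : Fin 2) : Hecke →ₗ[Coeff] Hecke := qHalf (-1) • mulGen s - qHalf 1 • LinearMap.id

theorem klC_one : klC 1 = Finsupp.single 1 1 := by
  rw [klC, lower, redWord_one]
  simp [wordProd]

theorem klC_gen (s : Fin 2) :
    klC (gen s) = Finsupp.single (gen s) (qHalf (-1)) - Finsupp.single 1 (qHalf 1) := by
  have hlower : lower (gen s) = {1, gen s} := by
    rw [lower, redWord_gen]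
    simp [wordProd]
  rw [klC, hlower, Finset.sum_pair (gen_ne_one s).symm, len_gen, len_one, add_comm]
  simp [sub_eq_add_neg]

theorem mulLeft_klC_one (a : Hecke) : mulLeft a (klC 1) = a := by
  rw [klC_one, mulLeft_single, redWord_one, List.foldl_nil, one_smul]

theorem mulLeft_klC_gen (a : Hecke) (s : Fin 2) : mulLeft a (klC (gen s)) = mulC s a := by
  rw [klC_gen, map_sub, mulLeft_single, mulLeft_single, redWord_one, redWord_gen]
  rfl

theorem mulLeft_mulC (s : Fin 2) (a b : Hecke) :
    mulLeft a (mulC s b) = mulC s (mulLeft a b) := by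
  simp only [mulC, LinearMap.sub_apply, LinearMap.smul_apply, map_sub, map_smul, mulLeft_mulGen,
    LinearMap.id_apply]

theorem mulC_apply (s : Fin 2) (a : Hecke) (z : AffineWeyl) :
    mulC s a z = qHalf (if IsRightDescent z s then -1 else 1) * (a (z * gen s) - a z) := by
  have hv : qHalf (-1) * qHalf 2 = qHalf 1 := qHalf_mul_qHalf _ _
  have hdef : mulC s a z = qHalf (-1) * mulGen s a z - qHalf 1 * a z := rfl
  rw [hdef, mulGen_apply, ← hv]
  split_ifs
  · ring
  · rw [← hv]
    ring

/-- The image of right multiplication by `C_s`. Its elements are determined by their coordinates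
at the elements of which `s` is a right descent. -/
def descentSubmodule (s : Fin 2) : Submodule Coeff Hecke where
  carrier := {a | ∀ z, IsRightDescent z s → a (z * gen s) = -qHalf 2 * a z}
  add_mem' ha hb z hz := by rw [Finsupp.add_apply, Finsupp.add_apply, ha z hz, hb z hz, mul_add]
  zero_mem' z _ := by simp
  smul_mem' c a ha z hz := by
    rw [Finsupp.smul_apply, Finsupp.smul_apply, ha z hz, smul_eq_mul, smul_eq_mul,
      mul_left_comm]

theorem mulC_mem_descentSubmodule (s : Fin 2) (a : Hecke) : mulC s a ∈ descentSubmodule s := by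
  intro z hz
  have hv : qHalf 2 * qHalf (-1) = qHalf 1 := qHalf_mul_qHalf _ _
  rw [mulC_apply, mulC_apply, mul_gen_mul_gen, if_pos hz, if_neg (by
    rwa [isRightDescent_mul_gen, not_not]), ← hv]
  ring

theorem ext_of_mem_descentSubmodule {s : Fin 2} {a b : Hecke} (ha : a ∈ descentSubmodule s)
    (hb : b ∈ descentSubmodule s) (h : ∀ z, IsRightDescent z s → a z = b z) : a = b := by
  ext1 z
  by_cases hz : IsRightDescent z s
  · exact h z hz
  · rw [← isRightDescent_mul_gen] at hz
    rw [← mul_gen_mul_gen z s, ha _ hz, hb _ hz, h _ hz]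

theorem mulC_eq_smul_of_mem_descentSubmodule {s : Fin 2} {a : Hecke}
    (ha : a ∈ descentSubmodule s) : mulC s a = -(qHalf 1 + qHalf (-1)) • a := by
  refine ext_of_mem_descentSubmodule (mulC_mem_descentSubmodule s a)
    (Submodule.smul_mem _ _ ha) fun z hz => ?_
  have hv : qHalf (-1) * qHalf 2 = qHalf 1 := qHalf_mul_qHalf _ _
  rw [mulC_apply, if_pos hz, ha z hz, Finsupp.smul_apply, smul_eq_mul, ← hv]
  ring

theorem klC_apply_eq_mul {w z w' z' : AffineWeyl} (n : ℕ) (m : ℤ)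
    (hmem : z ∈ lower w ↔ z' ∈ lower w')
    (hsign : (len w + len z) % 2 = (len w' + len z' + n) % 2)
    (hexp : (len w : ℤ) - 2 * len z = m + (len w' - 2 * len z')) :
    klC w z = (-1) ^ n * qHalf m * klC w' z' := by
  rw [klC_apply, klC_apply, if_congr hmem rfl rfl, mul_ite, mul_zero]
  split_ifs with h
  · have hle {x y : AffineWeyl} (hy : y ∈ lower x) : len y ≤ len x := by
      rw [mem_lower_iff] at hy
      exact hy.elim le_of_lt fun h => h ▸ le_rfl
    have h₁ := hle h
    have h₂ := hle (hmem.2 h)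
    have hpow : (-1 : Coeff) ^ (len w - len z) = (-1) ^ (n + (len w' - len z')) :=
      neg_one_pow_congr (by rw [Nat.even_iff, Nat.even_iff]; omega)
    rw [hexp, ← qHalf_mul_qHalf, hpow, pow_add]
    ring
  · rfl

theorem klC_mem_descentSubmodule {w : AffineWeyl} {s : Fin 2} (hw : IsRightDescent w s) :
    klC w ∈ descentSubmodule s := by
  intro z hz
  have hlen := isRightDescent_iff.1 hz
  have hlen' := isRightDescent_iff.1 hw
  have hne : z * gen s ≠ w := by
    rintro rfl
    exact isRightDescent_mul_gen.1 hw hz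
  refine (klC_apply_eq_mul (w' := w) (z' := z) 1 2 ?_ (by omega) (by omega)).trans (by ring)
  rw [mem_lower_iff_len_lt hne, mem_lower_iff_len_le (s := s) (iff_of_true hw hz)]
  omega

theorem isRightDescent_mul_gen_add_one {w : AffineWeyl} {s : Fin 2} (hs : ¬IsRightDescent w s)
    (hw : 2 ≤ len w) : IsRightDescent (w * gen (s + 1)) s := by
  have hw₁ : w ≠ 1 := by
    rintro rfl
    simp at hw
  have hdesc := (isRightDescent_add_one_iff hw₁).2 hs
  have hne : w * gen (s + 1) ≠ 1 := by
    rw [← len_eq_zero.ne]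
    have := isRightDescent_iff.1 hdesc
    omega
  by_contra h
  exact isRightDescent_mul_gen.1 ((isRightDescent_add_one_iff hne).2 h) hdesc

theorem mulC_klC_of_isRightDescent {w : AffineWeyl} {s : Fin 2} (hw : IsRightDescent w s) :
    mulC s (klC w) = -(qHalf 1 + qHalf (-1)) • klC w :=
  mulC_eq_smul_of_mem_descentSubmodule (klC_mem_descentSubmodule hw)

theorem mulC_klC_of_not_isRightDescent {w : AffineWeyl} {s : Fin 2}
    (hw : ¬IsRightDescent w s) :
    mulC s (klC w) = klC (w * gen s) + if 2 ≤ len w then klC (w * gen (s + 1)) else 0 := by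
  have hws := isRightDescent_mul_gen.2 hw
  have hlen := not_isRightDescent_iff.1 hw
  refine ext_of_mem_descentSubmodule (mulC_mem_descentSubmodule s _)
    (Submodule.add_mem _ (klC_mem_descentSubmodule hws) ?_) fun z hz => ?_
  · split_ifs with h
    · exact klC_mem_descentSubmodule (isRightDescent_mul_gen_add_one hw h)
    · exact Submodule.zero_mem _
  have hzs := isRightDescent_iff.1 hz
  have hne : z ≠ w := by
    rintro rfl
    exact hw hz
  have hlong : klC (w * gen s) z = qHalf (-1) * klC w (z * gen s) := by
    refine (klC_apply_eq_mul (w' := w) (z' := z * gen s) 0 (-1) ?_ (by omega)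
      (by omega)).trans (by ring)
    rw [mem_lower_iff_len_le (iff_of_true hws hz), mem_lower_iff_len_le (s := s)]
    · omega
    · rw [isRightDescent_mul_gen]
      exact iff_of_false hw (not_not.2 hz)
  have hshort : (if 2 ≤ len w then klC (w * gen (s + 1)) else 0) z = -qHalf (-1) * klC w z := by
    split_ifs with h
    · have hp := isRightDescent_mul_gen_add_one hw h
      have hp' := isRightDescent_iff.1 ((isRightDescent_add_one_iff (w := w) (by
        rintro rfl
        simp at h)).2 hw)
      refine (klC_apply_eq_mul (w' := w) (z' := z) 1 (-1) ?_ (by omega) (by omega)).trans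
        (by ring)
      rw [mem_lower_iff_len_le (iff_of_true hp hz), mem_lower_iff_len_lt hne]
      omega
    · rw [klC_apply, if_neg (by rw [mem_lower_iff_len_lt hne]; omega), mul_zero,
        Finsupp.zero_apply]
  rw [mulC_apply, if_pos hz, Finsupp.add_apply, hlong, hshort]
  ring

/-! ### Structure constants and the `a`-function -/

theorem repr_klC (w : AffineWeyl) : klBasis.repr (klC w) = Finsupp.single w 1 := by
  rw [← klBasis.repr_self w, klBasis, Module.Basis.mk_apply]

theorem structConst_one (x z : AffineWeyl) : structConst x 1 z = if x = z then 1 else 0 := by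
  classical
  rw [structConst, mul_eq_mulLeft, mulLeft_klC_one, repr_klC, Finsupp.single_apply]

/-- The integral combinations of the `C_w` with `w` having `s` as a right descent. -/
def endSpan (s : Fin 2) : AddSubgroup Hecke :=
  AddSubgroup.closure (klC '' {w | IsRightDescent w s})

theorem klC_mem_endSpan {s : Fin 2} {w : AffineWeyl} (hw : IsRightDescent w s) :
    klC w ∈ endSpan s := AddSubgroup.subset_closure ⟨w, hw, rfl⟩

theorem mulC_klC_mem_endSpan {s : Fin 2} {w : AffineWeyl} (hw : ¬IsRightDescent w s) :
    mulC s (klC w) ∈ endSpan s := by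
  rw [mulC_klC_of_not_isRightDescent hw]
  refine add_mem (klC_mem_endSpan (isRightDescent_mul_gen.2 hw)) ?_
  split_ifs with h
  · exact klC_mem_endSpan (isRightDescent_mul_gen_add_one hw h)
  · exact zero_mem _

theorem mulC_mem_endSpan {s t : Fin 2} (hst : s ≠ t) {a : Hecke} (ha : a ∈ endSpan s) :
    mulC t a ∈ endSpan t := by
  induction ha using AddSubgroup.closure_induction with
  | mem a ha =>
    obtain ⟨w, hw, rfl⟩ := ha
    exact mulC_klC_mem_endSpan fun ht => hst (IsRightDescent.unique hw ht)
  | zero => simp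
  | add a b _ _ ha hb => rw [map_add]; exact add_mem ha hb
  | neg a _ ha => rw [map_neg]; exact neg_mem ha

theorem repr_of_mem_endSpan {s : Fin 2} {a : Hecke} (ha : a ∈ endSpan s) (z : AffineWeyl) :
    ∃ m : ℤ, klBasis.repr a z = LaurentPolynomial.C m ∧ (z = 1 → m = 0) := by
  classical
  induction ha using AddSubgroup.closure_induction with
  | mem a ha =>
    obtain ⟨w, hw, rfl⟩ := ha
    refine ⟨if w = z then 1 else 0, ?_, fun hz => if_neg (hz ▸ hw.ne_one)⟩
    rw [repr_klC, Finsupp.single_apply]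
    split_ifs <;> simp
  | zero => exact ⟨0, by simp, fun _ => rfl⟩
  | add a b _ _ ha hb =>
    obtain ⟨m, hm, hm₁⟩ := ha
    obtain ⟨n, hn, hn₁⟩ := hb
    refine ⟨m + n, by rw [map_add, Finsupp.add_apply, hm, hn, map_add], fun h => ?_⟩
    rw [hm₁ h, hn₁ h, add_zero]
  | neg a _ ha =>
    obtain ⟨m, hm, hm₁⟩ := ha
    refine ⟨-m, by rw [map_neg, Finsupp.neg_apply, hm, map_neg], fun h => ?_⟩
    rw [hm₁ h, neg_zero]

theorem exists_mulC_klC_eq_smul (x : AffineWeyl) (s : Fin 2) :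
    ∃ c : Coeff, (c = 1 ∨ c = -(qHalf 1 + qHalf (-1))) ∧
      ∃ m ∈ endSpan s, mulC s (klC x) = c • m := by
  by_cases h : IsRightDescent x s
  · exact ⟨_, Or.inr rfl, _, klC_mem_endSpan h, mulC_klC_of_isRightDescent h⟩
  · exact ⟨1, Or.inl rfl, _, mulC_klC_mem_endSpan h, (one_smul _ _).symm⟩

theorem mulC_klC_ray {σ : ℤˣ} {n : ℕ} {s : Fin 2} (hs : IsRightDescent (ray σ (n + 2)) s) :
    mulC s (klC (ray σ (n + 1))) =
      klC (ray σ (n + 2)) + if 1 ≤ n then klC (ray σ n) else 0 := by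
  have hn := isRightDescent_ray_add_two.1 hs
  have hback := (isRightDescent_add_one_iff (ray_ne_one (by omega))).2 hn
  rw [mulC_klC_of_not_isRightDescent hn, ray_mul_gen_of_not_isRightDescent hn,
    ray_mul_gen_of_isRightDescent hback, len_ray]
  simp only [Nat.reduceLeDiff]

theorem exists_mulLeft_klC_ray_eq_smul {a m : Hecke} {c : Coeff} {σ : ℤˣ} {t : Fin 2}
    (ht : gen t = ray σ 1) (hm : m ∈ endSpan t) (ha : mulC t a = c • m) (n : ℕ) :
    ∀ s, IsRightDescent (ray σ (n + 1)) s →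
      ∃ m' ∈ endSpan s, mulLeft a (klC (ray σ (n + 1))) = c • m' := by
  induction n using Nat.twoStepInduction with
  | zero =>
    intro s hs
    rw [zero_add, ← ht] at hs ⊢
    obtain rfl := hs.unique (isRightDescent_gen t)
    exact ⟨m, hm, by rw [mulLeft_klC_gen, ha]⟩
  | one =>
    intro s hs
    obtain ⟨r, hr⟩ := exists_isRightDescent (ray_ne_one (σ := σ) le_rfl)
    have hrs : r ≠ s := fun h => isRightDescent_ray_add_two.1 hs (h ▸ hr)
    rw [← ht] at hr
    obtain rfl := hr.unique (isRightDescent_gen t)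
    have hmul := congrArg (mulLeft a) (mulC_klC_ray hs)
    rw [mulLeft_mulC, zero_add, ← ht, mulLeft_klC_gen, ha, map_smul, if_neg (by omega),
      add_zero] at hmul
    exact ⟨_, mulC_mem_endSpan hrs hm, hmul.symm⟩
  | more n ih₁ ih₂ =>
    intro s hs
    have hn := isRightDescent_ray_add_two.1 hs
    obtain ⟨r, hr⟩ := exists_isRightDescent (ray_ne_one (σ := σ) (n := n + 2) (by omega))
    have hrs : r ≠ s := fun h => hn (h ▸ hr)
    obtain ⟨m₁, hm₁, hcm₁⟩ := ih₁ s (not_not.1 (mt isRightDescent_ray_add_two.2 hn))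
    obtain ⟨m₂, hm₂, hcm₂⟩ := ih₂ r hr
    have hmul := congrArg (mulLeft a) (mulC_klC_ray hs)
    rw [mulLeft_mulC, hcm₂, map_smul, map_add, if_pos (by omega), hcm₁] at hmul
    exact ⟨mulC s m₂ - m₁, sub_mem (mulC_mem_endSpan hrs hm₂) hm₁, by
      rw [smul_sub, hmul, add_sub_cancel_right]⟩

theorem structConst_eq (x z : AffineWeyl) {y : AffineWeyl} (hy : y ≠ 1) :
    ∃ m : ℤ, (z = 1 → m = 0) ∧ (structConst x y z = LaurentPolynomial.C m ∨
      structConst x y z = -(qHalf 1 + qHalf (-1)) * LaurentPolynomial.C m) := by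
  obtain ⟨t, ht⟩ := exists_gen_eq_ray_one (direction y)
  obtain ⟨s, hs⟩ := exists_isRightDescent hy
  obtain ⟨c, hc, m, hm, hcm⟩ := exists_mulC_klC_eq_smul x t
  obtain ⟨n, hn⟩ : ∃ n, len y = n + 1 := Nat.exists_eq_succ_of_ne_zero (len_eq_zero.not.2 hy)
  rw [← ray_direction_len y, hn] at hs
  obtain ⟨m', hm', hcm'⟩ := exists_mulLeft_klC_ray_eq_smul ht hm hcm n s hs
  rw [← hn, ray_direction_len] at hcm'
  obtain ⟨k, hk, hk₁⟩ := repr_of_mem_endSpan hm' z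
  refine ⟨k, hk₁, ?_⟩
  rw [structConst, mul_eq_mulLeft, hcm', map_smul, Finsupp.smul_apply, hk, smul_eq_mul]
  exact hc.imp (fun h => by rw [h, one_mul]) fun h => by rw [h]

theorem mul_gen_eq_iff {x z : AffineWeyl} {s : Fin 2} : x * gen s = z ↔ x = z * gen s :=
  ⟨fun h => by rw [← h, mul_gen_mul_gen], fun h => by rw [h, mul_gen_mul_gen]⟩

theorem structConst_gen_of_isRightDescent {z : AffineWeyl} {s : Fin 2} (hz : IsRightDescent z s)
    (x : AffineWeyl) :
    structConst x (gen s) z = (if x = z * gen s then 1 else 0) +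
      (if x = z * gen (s + 1) then 1 else 0) - if x = z then qHalf 1 + qHalf (-1) else 0 := by
  classical
  rw [structConst, mul_eq_mulLeft, mulLeft_klC_gen]
  by_cases hx : IsRightDescent x s
  · have hs : x ≠ z * gen s := by
      rintro rfl
      exact isRightDescent_mul_gen.1 hx hz
    have ht : x ≠ z * gen (s + 1) := by
      rintro rfl
      exact hx.not_add_one (isRightDescent_mul_gen.2 hz.not_add_one)
    rw [mulC_klC_of_isRightDescent hx, map_smul, repr_klC, Finsupp.smul_apply,
      Finsupp.single_apply, if_neg hs, if_neg ht]
    split_ifs <;> simp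
  · have hne : x ≠ z := by
      rintro rfl
      exact hx hz
    have hlen : x = z * gen (s + 1) → 2 ≤ len x := by
      rintro rfl
      have := isRightDescent_iff.1 hz
      rw [not_isRightDescent_iff.1 hz.not_add_one]
      omega
    rw [mulC_klC_of_not_isRightDescent hx, map_add, repr_klC, Finsupp.add_apply,
      Finsupp.single_apply, if_neg hne, sub_zero, if_congr mul_gen_eq_iff rfl rfl]
    congr 1
    by_cases h : 2 ≤ len x
    · rw [if_pos h, repr_klC, Finsupp.single_apply, if_congr mul_gen_eq_iff rfl rfl]
    · rw [if_neg h, if_neg (mt hlen h), map_zero, Finsupp.zero_apply]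

theorem structConst_gen_of_not_isRightDescent {z : AffineWeyl} {s : Fin 2}
    (hz : ¬IsRightDescent z s) (x : AffineWeyl) : structConst x (gen s) z = 0 := by
  classical
  have hrepr {w : AffineWeyl} (hw : IsRightDescent w s) : klBasis.repr (klC w) z = 0 := by
    rw [repr_klC, Finsupp.single_eq_of_ne]
    rintro rfl
    exact hz hw
  rw [structConst, mul_eq_mulLeft, mulLeft_klC_gen]
  by_cases hx : IsRightDescent x s
  · rw [mulC_klC_of_isRightDescent hx, map_smul, Finsupp.smul_apply, hrepr hx, smul_zero]
  · rw [mulC_klC_of_not_isRightDescent hx, map_add, Finsupp.add_apply,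
      hrepr (isRightDescent_mul_gen.2 hx), zero_add]
    split_ifs with h
    · exact hrepr (isRightDescent_mul_gen_add_one hx h)
    · rw [map_zero, Finsupp.zero_apply]

theorem coeff_C_mul_qHalf (m k n : ℤ) :
    (LaurentPolynomial.C m * qHalf k : Coeff).coeff n = if k = n then m else 0 := by
  rw [qHalf, ← LaurentPolynomial.single_eq_C_mul_T, AddMonoidAlgebra.coeff_single,
    Finsupp.single_apply]

theorem coeff_C_of_ne_zero (m : ℤ) {n : ℤ} (hn : n ≠ 0) :
    (LaurentPolynomial.C m : Coeff).coeff n = 0 := by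
  have h := coeff_C_mul_qHalf m 0 n
  rwa [qHalf, LaurentPolynomial.T_zero, mul_one, if_neg hn.symm] at h

theorem structConst_one_right_coeff (x y : AffineWeyl) {k : ℤ} (hk : k < 0) :
    (structConst x y 1).coeff k = 0 := by
  by_cases hy : y = 1
  · rw [hy, structConst_one]
    split_ifs
    · rw [← map_one LaurentPolynomial.C]
      exact coeff_C_of_ne_zero 1 hk.ne
    · rfl
  · obtain ⟨m, hm, h⟩ := structConst_eq x 1 hy
    rw [hm rfl, map_zero, mul_zero, or_self] at h
    rw [h]
    rfl

theorem neg_qHalf_one_mul_structConst_coeff (x y z : AffineWeyl) {k : ℤ} (hk : k < 0) :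
    (-qHalf 1 * structConst x y z).coeff k = 0 := by
  obtain ⟨m, h⟩ : ∃ m : ℤ, structConst x y z = LaurentPolynomial.C m ∨
      structConst x y z = -(qHalf 1 + qHalf (-1)) * LaurentPolynomial.C m := by
    by_cases hy : y = 1
    · refine ⟨if x = z then 1 else 0, Or.inl ?_⟩
      rw [hy, structConst_one]
      split_ifs <;> simp
    · obtain ⟨m, -, h⟩ := structConst_eq x z hy
      exact ⟨m, h⟩
  rcases h with h | h
  · have hC : -qHalf 1 * LaurentPolynomial.C m = LaurentPolynomial.C (-m) * qHalf 1 := by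
      rw [map_neg]
      ring
    rw [h, hC, coeff_C_mul_qHalf, if_neg (by omega)]
  · have hC : -qHalf 1 * (-(qHalf 1 + qHalf (-1)) * LaurentPolynomial.C m) =
        LaurentPolynomial.C m * qHalf 2 + LaurentPolynomial.C m * qHalf 0 := by
      have h₂ : qHalf 1 * qHalf 1 = qHalf 2 := qHalf_mul_qHalf _ _
      have h₀ : qHalf 1 * qHalf (-1) = qHalf 0 := qHalf_mul_qHalf _ _
      rw [← h₂, ← h₀]
      ring
    rw [h, hC, AddMonoidAlgebra.coeff_add, Finsupp.add_apply, coeff_C_mul_qHalf,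
      coeff_C_mul_qHalf, if_neg (by omega), if_neg (by omega), add_zero]

theorem aFun_one : aFun 1 = 0 :=
  Nat.sInf_eq_zero.2 <| Or.inl fun x y k hk => by
    rw [pow_zero, one_mul, structConst_one_right_coeff x y hk]

theorem aFun_of_ne_one {z : AffineWeyl} (hz : z ≠ 1) : aFun z = 1 := by
  have hone : 1 ∈ {n | ∀ x y, ∀ k < 0, ((-qHalf 1) ^ n * structConst x y z).coeff k = 0} :=
    fun x y k hk => by rw [pow_one, neg_qHalf_one_mul_structConst_coeff x y z hk]
  refine le_antisymm (Nat.sInf_le hone) (Nat.one_le_iff_ne_zero.2 fun h => ?_)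
  have hzero := Nat.sInf_mem ⟨1, hone⟩
  rw [show sInf _ = 0 from h] at hzero
  obtain ⟨s, hs⟩ := exists_isRightDescent hz
  have hcoeff := hzero z (gen s) (-1) (by omega)
  have hpole : structConst z (gen s) z =
      LaurentPolynomial.C (-1) * qHalf 1 + LaurentPolynomial.C (-1) * qHalf (-1) := by
    rw [structConst_gen_of_isRightDescent hs]
    simp [gen_ne_one, sub_eq_add_neg, add_comm]
  rw [pow_zero, one_mul, hpole, AddMonoidAlgebra.coeff_add, Finsupp.add_apply,
    coeff_C_mul_qHalf, coeff_C_mul_qHalf] at hcoeff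
  simp at hcoeff

/-! ### The map `φ` in coordinates -/

theorem toSeries_add (c d : Coeff) : toSeries (c + d) = toSeries c + toSeries d := by
  ext k
  simp [toSeries]

theorem toSeries_neg (c : Coeff) : toSeries (-c) = -toSeries c := by
  ext k
  simp [toSeries]

theorem toSeries_zero : toSeries 0 = 0 := by
  ext k
  simp [toSeries]

theorem toSeries_qHalf (n : ℤ) : toSeries (qHalf n) = HahnSeries.single n 1 := by
  ext k
  change (qHalf n).coeff k = _
  rw [LaurentPolynomial.T_apply, HahnSeries.coeff_single]
  simp only [eq_comm]

theorem toSeries_one : toSeries 1 = 1 := by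
  rw [← LaurentPolynomial.T_zero]
  exact toSeries_qHalf 0

theorem filter_distInv_one : (distInv.filter fun d => aFun d = aFun 1) = {1} := by
  ext d
  simp only [distInv, Finset.mem_filter, Finset.mem_insert, Finset.mem_singleton, aFun_one]
  refine ⟨fun ⟨_, h⟩ => ?_, fun h => ⟨Or.inl h, h ▸ aFun_one⟩⟩
  by_contra hd
  rw [aFun_of_ne_one hd] at h
  exact one_ne_zero h

theorem filter_distInv_of_ne_one {z : AffineWeyl} (hz : z ≠ 1) (s : Fin 2) :
    (distInv.filter fun d => aFun d = aFun z) = {gen s, gen (s + 1)} := by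
  have hpair : ({gen s, gen (s + 1)} : Finset AffineWeyl) = {gen 0, gen 1} := by
    fin_cases s
    · rfl
    · exact Finset.pair_comm _ _
  rw [distInv, Finset.filter_insert, if_neg (by rw [aFun_one, aFun_of_ne_one hz]; omega), hpair]
  refine Finset.filter_true_of_mem fun d hd => ?_
  rw [Finset.mem_insert, Finset.mem_singleton] at hd
  rcases hd with rfl | rfl <;> rw [aFun_of_ne_one hz, aFun_of_ne_one (gen_ne_one _)]

theorem phi_one (b : AffineWeyl → LaurentSeries ℤ) : phi b 1 = b 1 := by
  simp only [phi, filter_distInv_one, Finset.sum_singleton, structConst_one]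
  rw [finsum_eq_single _ 1 fun x hx => by rw [if_neg hx, toSeries_zero, mul_zero], if_pos rfl,
    toSeries_one, mul_one]

theorem gen_add_one_ne (s : Fin 2) : gen (s + 1) ≠ gen s := by
  intro h
  exact (isRightDescent_gen s).not_add_one (h ▸ isRightDescent_gen (s + 1))

theorem phi_of_isRightDescent (b : AffineWeyl → LaurentSeries ℤ) {z : AffineWeyl} {s : Fin 2}
    (hz : IsRightDescent z s) :
    phi b z = b (z * gen s) + b (z * gen (s + 1)) -
      b z * (HahnSeries.single 1 1 + HahnSeries.single (-1) 1) := by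
  have hterm (x : AffineWeyl) : ∑ d ∈ distInv with aFun d = aFun z,
      b x * toSeries (structConst x d z) =
        (if x = z * gen s then b x else 0) + (if x = z * gen (s + 1) then b x else 0) -
          if x = z then b x * (HahnSeries.single 1 1 + HahnSeries.single (-1) 1) else 0 := by
    rw [filter_distInv_of_ne_one hz.ne_one s, Finset.sum_pair (gen_add_one_ne s).symm,
      structConst_gen_of_not_isRightDescent hz.not_add_one, toSeries_zero, mul_zero, add_zero,
      structConst_gen_of_isRightDescent hz, sub_eq_add_neg, toSeries_add, toSeries_add,
      toSeries_neg]
    split_ifs <;>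
      simp only [toSeries_zero, toSeries_one, toSeries_add, toSeries_qHalf] <;> ring
  simp only [phi, hterm]
  rw [finsum_eq_sum_of_support_subset (s := {z * gen s, z * gen (s + 1), z})]
  · rw [Finset.sum_sub_distrib, Finset.sum_add_distrib, Finset.sum_ite_eq', Finset.sum_ite_eq',
      Finset.sum_ite_eq']
    simp
  · intro x hx
    contrapose! hx
    simp_all

theorem phi_ray (b : AffineWeyl → LaurentSeries ℤ) (σ : ℤˣ) (n : ℕ) :
    phi b (ray σ (n + 1)) = b (ray σ (n + 2)) + b (ray σ n) -
      b (ray σ (n + 1)) * (HahnSeries.single 1 1 + HahnSeries.single (-1) 1) := by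
  obtain ⟨s, hs⟩ := exists_isRightDescent (ray_ne_one (σ := σ) (n := n + 1) (by omega))
  rw [phi_of_isRightDescent b hs, ray_mul_gen_of_isRightDescent hs,
    ray_mul_gen_of_not_isRightDescent hs.not_add_one, add_comm (b (ray σ n))]

/-! ### The preimage of `t_y` -/

/-- The recursion has the characteristic roots `v` and `v⁻¹`, and a solution vanishing at `0` is a
multiple of `v⁻ⁿ + v⁻ⁿ⁺² + ⋯ + vⁿ`, which does not tend to zero. -/
theorem eq_zero_of_recursion {R : Type*} [CommRing R] {b : ℕ → LaurentSeries R} (hzero : b 0 = 0)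
    (hrec : ∀ n, b (n + 2) + b n - b (n + 1) *
      (HahnSeries.single 1 1 + HahnSeries.single (-1) 1) = 0)
    (hb : ∀ N : ℤ, ∃ L : ℕ, ∀ n, L ≤ n → ∀ k < N, (b n).coeff k = 0) (n : ℕ) : b n = 0 := by
  have hdiff (n : ℕ) :
      b (n + 1) - HahnSeries.single 1 1 * b n = HahnSeries.single (-(n : ℤ)) 1 * b 1 := by
    induction n with
    | zero => simp [hzero]
    | succ n ih =>
      have hinv : (HahnSeries.single 1 1 * HahnSeries.single (-1) 1 : LaurentSeries R) = 1 := by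
        simp
      have hstep : (HahnSeries.single (-((n + 1 : ℕ) : ℤ)) 1 : LaurentSeries R) =
          HahnSeries.single (-1) 1 * HahnSeries.single (-(n : ℤ)) 1 := by
        rw [HahnSeries.single_mul_single, one_mul, Nat.cast_succ, neg_add_rev]
      rw [hstep, mul_assoc, ← ih]
      linear_combination hrec n + b n * hinv
  have hone : b 1 = 0 := by
    ext k
    obtain ⟨L, hL⟩ := hb (k + 1)
    have hcoeff := congrArg (fun f : LaurentSeries R => f.coeff (k - L)) (hdiff L)
    simp only [HahnSeries.coeff_sub, HahnSeries.coeff_single_mul, one_mul] at hcoeff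
    rw [hL (L + 1) (by omega) _ (by omega), hL L le_rfl _ (by omega), sub_neg_eq_add,
      sub_add_cancel, sub_zero] at hcoeff
    rw [← hcoeff, HahnSeries.coeff_zero]
  induction n with
  | zero => exact hzero
  | succ n ih => simpa [ih, hone] using hdiff n

theorem phi_jHat_add (a a' : AffineWeyl → LaurentSeries ℤ) :
    phi (jHat (a + a')) = phi (jHat a) + phi (jHat a') := by
  funext z
  obtain rfl | ⟨σ, n, rfl⟩ := eq_one_or_exists_eq_ray z
  · simp only [Pi.add_apply, phi_one, jHat, mul_add]
  · simp only [Pi.add_apply, phi_ray, jHat]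
    ring

/-- The composition of `φ` and `j` as an additive map on families of coefficients. -/
def phiJ : (AffineWeyl → LaurentSeries ℤ) →+ (AffineWeyl → LaurentSeries ℤ) :=
  AddMonoidHom.mk' (fun a => phi (jHat a)) phi_jHat_add

theorem phiJ_one (a : AffineWeyl → LaurentSeries ℤ) : phiJ a 1 = jHat a 1 := phi_one _

theorem phiJ_ray (a : AffineWeyl → LaurentSeries ℤ) (σ : ℤˣ) (n : ℕ) :
    phiJ a (ray σ (n + 1)) = jHat a (ray σ (n + 2)) + jHat a (ray σ n) -
      jHat a (ray σ (n + 1)) * (HahnSeries.single 1 1 + HahnSeries.single (-1) 1) :=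
  phi_ray _ σ n

/-- The completed Hecke algebra, as the group of families of coefficients tending to zero. -/
def nullFamilies : AddSubgroup (AffineWeyl → LaurentSeries ℤ) where
  carrier := {a | TendsToZero a}
  zero_mem' _ := ⟨0, fun _ _ _ _ => rfl⟩
  add_mem' {a b} ha hb N := by
    obtain ⟨L, hL⟩ := ha N
    obtain ⟨L', hL'⟩ := hb N
    refine ⟨max L L', fun x hx k hk => ?_⟩
    rw [Pi.add_apply, HahnSeries.coeff_add, hL x (by omega) k hk, hL' x (by omega) k hk, add_zero]
  neg_mem' {a} ha N := by
    obtain ⟨L, hL⟩ := ha N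
    refine ⟨L, fun x hx k hk => ?_⟩
    rw [Pi.neg_apply, HahnSeries.coeff_neg, hL x hx k hk, neg_zero]

theorem jHat_coeff (a : AffineWeyl → LaurentSeries ℤ) (x : AffineWeyl) (k : ℤ) :
    (jHat a x).coeff k = (-1) ^ len x * (a x).coeff k := by
  rw [jHat]
  rcases Nat.even_or_odd (len x) with h | h <;> simp [h.neg_one_pow]

theorem eq_zero_of_phiJ_eq_zero {a : AffineWeyl → LaurentSeries ℤ} (ha : a ∈ nullFamilies)
    (hphi : phiJ a = 0) : a = 0 := by
  have hray (σ : ℤˣ) (n : ℕ) : jHat a (ray σ n) = 0 := by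
    refine eq_zero_of_recursion (b := fun n => jHat a (ray σ n)) ?_ (fun n => ?_) (fun N => ?_) n
    · rw [ray_zero, ← phiJ_one, hphi, Pi.zero_apply]
    · rw [← phiJ_ray, hphi, Pi.zero_apply]
    · obtain ⟨L, hL⟩ := ha N
      exact ⟨L, fun n hn k hk => by rw [jHat_coeff, hL _ (by rwa [len_ray]) k hk, mul_zero]⟩
  funext x
  have hx := hray (direction x) (len x)
  rw [ray_direction_len, jHat] at hx
  exact (mul_eq_zero.1 hx).resolve_left (pow_ne_zero _ (neg_ne_zero.2 one_ne_zero))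

open scoped Classical in
/-- The family with coefficients `(-1)^{ℓ(x)} v^{ℓ(x) + c}` at the elements `x` starting with
`u`, where `v` is the variable. -/
def coneFamily (u : AffineWeyl) (c : ℤ) (x : AffineWeyl) : LaurentSeries ℤ :=
  if StartsWith x u then HahnSeries.single (len x + c) ((-1) ^ len x) else 0

theorem coneFamily_mem_nullFamilies (u : AffineWeyl) (c : ℤ) : coneFamily u c ∈ nullFamilies := by
  refine fun N => ⟨(N - c).toNat, fun x hx m hm => ?_⟩
  rw [coneFamily]
  split_ifs
  · rw [HahnSeries.coeff_single_of_ne (by omega)]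
  · rfl

open scoped Classical in
theorem jHat_coneFamily (u : AffineWeyl) (c : ℤ) (x : AffineWeyl) :
    jHat (coneFamily u c) x = if StartsWith x u then HahnSeries.single (len x + c) 1 else 0 := by
  rw [jHat, coneFamily, mul_ite, mul_zero]
  rcases Nat.even_or_odd (len x) with h | h <;> simp [h.neg_one_pow]

theorem phiJ_coneFamily_one : phiJ (coneFamily 1 0) = Pi.single 1 1 := by
  funext z
  obtain rfl | ⟨τ, n, rfl⟩ := eq_one_or_exists_eq_ray z
  · rw [phiJ_one, jHat_coneFamily, if_pos (startsWith_one_right 1), Pi.single_eq_same, len_one]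
    rfl
  · rw [phiJ_ray, Pi.single_eq_of_ne (ray_ne_one (by omega))]
    simp only [jHat_coneFamily, startsWith_one_right, if_true, len_ray, mul_add,
      HahnSeries.single_mul_single, mul_one, add_zero, Nat.cast_add, Nat.cast_one, Nat.cast_ofNat,
      add_assoc, Int.reduceAdd, Int.reduceNeg, sub_self]

theorem jHat_coneFamily_ray_ray {σ τ : ℤˣ} {k : ℕ} (hk : 1 ≤ k) (c : ℤ) (m : ℕ) :
    jHat (coneFamily (ray σ k) c) (ray τ m) =
      if τ = σ ∧ k ≤ m then HahnSeries.single (m + c) 1 else 0 := by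
  simp only [jHat_coneFamily, len_ray, startsWith_ray_ray_iff hk]

theorem phiJ_coneFamily_ray_ray (σ τ : ℤˣ) (j n : ℕ) (c : ℤ) :
    phiJ (coneFamily (ray σ (j + 1)) c) (ray τ (n + 1)) =
      (if τ = σ ∧ n + 1 = j then HahnSeries.single (j + 1 + c) 1 else 0) -
        if τ = σ ∧ n + 1 = j + 1 then HahnSeries.single (j + c) 1 else 0 := by
  have hpow (m k : ℤ) : (HahnSeries.single m 1 : LaurentSeries ℤ) * HahnSeries.single k 1 =
      HahnSeries.single (m + k) 1 := by rw [HahnSeries.single_mul_single, one_mul]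
  rw [phiJ_ray, jHat_coneFamily_ray_ray (by omega), jHat_coneFamily_ray_ray (by omega),
    jHat_coneFamily_ray_ray (by omega)]
  by_cases hτ : τ = σ
  · have hright : (n + 1 + c + 1 : ℤ) = n + 2 + c := by ring
    have hleft : (n + 1 + c + -1 : ℤ) = n + c := by ring
    simp only [hτ, true_and, Nat.cast_add, Nat.cast_one, Nat.cast_ofNat, mul_add, ite_mul,
      zero_mul, hpow, hright, hleft]
    rcases lt_trichotomy n j with h | rfl | h
    · rw [if_neg (show ¬j + 1 ≤ n by omega), if_neg (show ¬j + 1 ≤ n + 1 by omega),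
        if_neg (show ¬j + 1 ≤ n + 1 by omega), if_neg (show n + 1 ≠ j + 1 by omega)]
      have hj : (j + 1 ≤ n + 2) ↔ n + 1 = j := by omega
      simp only [hj, add_zero, sub_zero]
      split_ifs with h
      · rw [← h, Nat.cast_succ, add_assoc (n : ℤ) 1 1, one_add_one_eq_two]
      · rfl
    · simp
    · rw [if_pos (by omega), if_pos (by omega), if_pos (by omega), if_pos (by omega),
        if_neg (by omega), if_neg (by omega)]
      ring
  · simp [hτ]

theorem single_ray_apply_ray {R : Type*} [Zero R] {σ : ℤˣ} {k : ℕ} (hk : 1 ≤ k) (f : R) (τ : ℤˣ)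
    (m : ℕ) :
    Pi.single (M := fun _ => R) (ray σ k) f (ray τ m) = if τ = σ ∧ m = k then f else 0 := by
  split_ifs with h
  · rw [h.1, h.2, Pi.single_eq_same]
  · rw [Pi.single_eq_of_ne (mt (ray_eq_ray_iff hk).1 h)]

theorem phiJ_coneFamily_ray (σ : ℤˣ) (j : ℕ) (c : ℤ) :
    phiJ (coneFamily (ray σ (j + 1)) c) =
      (if j = 0 then 0 else Pi.single (ray σ j) (HahnSeries.single (j + 1 + c) 1)) -
        Pi.single (ray σ (j + 1)) (HahnSeries.single (j + c) 1) := by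
  funext z
  obtain rfl | ⟨τ, n, rfl⟩ := eq_one_or_exists_eq_ray z
  · rw [phiJ_one, ← ray_zero σ, jHat_coneFamily_ray_ray (by omega), if_neg (by omega), ray_zero]
    split_ifs with hj
    · simp [(ray_ne_one (Nat.le_add_left 1 j)).symm]
    · simp [(ray_ne_one (Nat.le_add_left 1 j)).symm, (ray_ne_one (Nat.pos_of_ne_zero hj)).symm]
  · rw [phiJ_coneFamily_ray_ray, Pi.sub_apply, single_ray_apply_ray (by omega)]
    obtain rfl | hj := eq_or_ne j 0
    · simp
    · rw [if_neg hj, single_ray_apply_ray (Nat.pos_of_ne_zero hj)]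

theorem sum_phiJ_coneFamily_ray (σ : ℤˣ) (n : ℤ) (m : ℕ) :
    ∑ k ∈ Finset.Icc 1 m, phiJ (coneFamily (ray σ k) (n + 1 - 2 * k)) =
      if m = 0 then 0 else -Pi.single (ray σ m) (HahnSeries.single (n - m) 1) := by
  induction m with
  | zero => simp
  | succ m ih =>
    rw [Finset.sum_Icc_succ_top (by omega), ih, phiJ_coneFamily_ray, if_neg (Nat.succ_ne_zero m),
      show (m : ℤ) + 1 + (n + 1 - 2 * (m + 1 : ℕ)) = n - m by push_cast; ring,
      show (m : ℤ) + (n + 1 - 2 * (m + 1 : ℕ)) = n - (m + 1 : ℕ) by push_cast; ring]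
    split_ifs
    · rw [zero_add, zero_sub]
    · abel

/-- The preimage of `t_y` under `φ ∘ j`. -/
def preimageT (y : AffineWeyl) : AffineWeyl → LaurentSeries ℤ :=
  if y = 1 then coneFamily 1 0
  else -∑ k ∈ Finset.Icc 1 (len y), coneFamily (ray (direction y) k) (len y + 1 - 2 * k)

theorem preimageT_mem_nullFamilies (y : AffineWeyl) : preimageT y ∈ nullFamilies := by
  rw [preimageT]
  split_ifs
  · exact coneFamily_mem_nullFamilies _ _
  · exact neg_mem (sum_mem fun k _ => coneFamily_mem_nullFamilies _ _)

theorem phiJ_preimageT (y : AffineWeyl) : phiJ (preimageT y) = Pi.single y 1 := by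
  rw [preimageT]
  split_ifs with hy
  · rw [hy, phiJ_coneFamily_one]
  · rw [map_neg, map_sum, sum_phiJ_coneFamily_ray, if_neg (len_eq_zero.not.2 hy), neg_neg,
      sub_self, ray_direction_len]
    rfl

theorem isPreimageT_iff {y : AffineWeyl} {a : AffineWeyl → LaurentSeries ℤ} :
    IsPreimageT y a ↔ a = preimageT y := by
  refine ⟨fun ⟨hnull, hphi⟩ => sub_eq_zero.1 (eq_zero_of_phiJ_eq_zero
    (sub_mem (show a ∈ nullFamilies from hnull) (preimageT_mem_nullFamilies y)) ?_), ?_⟩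
  · rw [map_sub, phiJ_preimageT, sub_eq_zero]
    exact hphi
  · rintro rfl
    exact ⟨preimageT_mem_nullFamilies y, phiJ_preimageT y⟩

/-! ### The coefficients of `t_y` with respect to `T_w` -/

theorem jInv_apply (a : Hecke) (w : AffineWeyl) :
    jInv a w = LaurentPolynomial.invert (a w) * ((-1) ^ len w * qHalf (-2 * len w)) := by
  rw [jInv, Finsupp.sum_apply, Finsupp.sum_eq_single w, Finsupp.single_eq_same]
  · exact fun x _ hx => Finsupp.single_eq_of_ne hx.symm
  · intro _
    rw [map_zero, zero_mul, Finsupp.single_zero, Finsupp.zero_apply]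

theorem klC'_apply (x w : AffineWeyl) :
    klC' x w = if w ∈ lower x then qHalf (-(len x : ℤ)) else 0 := by
  rw [klC', Finsupp.smul_apply, jInv_apply, klC_apply, smul_eq_mul]
  split_ifs with h
  · have hle : len w ≤ len x := (mem_lower_iff.1 h).elim le_of_lt fun h => h ▸ le_rfl
    have hsign : (-1 : Coeff) ^ len x * (-1) ^ (len x - len w) * (-1) ^ len w = 1 := by
      rw [mul_assoc, ← pow_add, Nat.sub_add_cancel hle, ← pow_add, Even.neg_one_pow ⟨_, rfl⟩]
    have hexp : (qHalf (-(len x - 2 * len w : ℤ)) * qHalf (-2 * len w) : Coeff) =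
        qHalf (-(len x : ℤ)) := by
      rw [← LaurentPolynomial.T_add]
      congr 1
      ring
    rw [map_mul, map_pow, map_neg, map_one, LaurentPolynomial.invert_T]
    linear_combination qHalf (-(len x - 2 * len w : ℤ)) * qHalf (-2 * len w) * hsign + hexp
  · rw [map_zero, zero_mul, mul_zero]

/-- The contribution of `a_x C'_x` to the coefficient of `q^{-m/2}` in the coefficient of `T_w` in
`∑ a_x C'_x`. -/
def termCoeff (a : AffineWeyl → LaurentSeries ℤ) (w : AffineWeyl) (m : ℤ) (x : AffineWeyl) : ℤ :=
  if w ∈ lower x then (a x).coeff (m - len x) else 0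

theorem tCoeff_eq_finsum_termCoeff (a : AffineWeyl → LaurentSeries ℤ) (w : AffineWeyl) (m : ℤ) :
    tCoeff a w m = ∑ᶠ x, termCoeff a w m x := by
  refine finsum_congr fun x => ?_
  rw [klC'_apply, termCoeff]
  split_ifs
  · rw [LaurentPolynomial.invert_T, neg_neg, toSeries_qHalf, HahnSeries.coeff_mul_single, mul_one]
  · rw [map_zero, toSeries_zero, mul_zero, HahnSeries.coeff_zero]

theorem finite_setOf_len_le (n : ℕ) : {x | len x ≤ n}.Finite := by
  refine ((Set.finite_Icc (-n : ℤ) n).preimage pos_injective.injOn).subset fun x hx => ?_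
  rw [Set.mem_ofPred_eq, len_eq_natAbs_pos] at hx
  rw [Set.mem_preimage, Set.mem_Icc]
  omega

theorem finite_support_termCoeff {a : AffineWeyl → LaurentSeries ℤ} (ha : a ∈ nullFamilies)
    (w : AffineWeyl) (m : ℤ) : (Function.support (termCoeff a w m)).Finite := by
  obtain ⟨L, hL⟩ := ha (m + 1)
  refine (finite_setOf_len_le L).subset fun x hx => ?_
  by_contra hlen
  rw [Set.mem_ofPred_eq, not_le] at hlen
  refine hx ?_
  rw [termCoeff, hL x hlen.le _ (by omega), ite_self]

theorem tCoeff_neg (a : AffineWeyl → LaurentSeries ℤ) (w : AffineWeyl) (m : ℤ) :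
    tCoeff (-a) w m = -tCoeff a w m := by
  simp only [tCoeff_eq_finsum_termCoeff, ← finsum_neg_distrib]
  refine finsum_congr fun x => ?_
  simp only [termCoeff, Pi.neg_apply, HahnSeries.coeff_neg]
  split_ifs
  exacts [rfl, neg_zero.symm]

theorem tCoeff_sum {ι : Type*} (I : Finset ι) {a : ι → AffineWeyl → LaurentSeries ℤ}
    (ha : ∀ i ∈ I, a i ∈ nullFamilies) (w : AffineWeyl) (m : ℤ) :
    tCoeff (∑ i ∈ I, a i) w m = ∑ i ∈ I, tCoeff (a i) w m := by
  simp only [tCoeff_eq_finsum_termCoeff]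
  rw [← finsum_sum_comm I _ fun i hi => finite_support_termCoeff (ha i hi) w m]
  refine finsum_congr fun x => ?_
  simp only [termCoeff, Finset.sum_apply, HahnSeries.coeff_sum]
  split_ifs
  exacts [rfl, Finset.sum_const_zero.symm]

/-- The number of elements of length `j` that start with `u` and are above `w` in the Bruhat
order. -/
def coneCount (u w : AffineWeyl) (j : ℕ) : ℕ :=
  {x | len x = j ∧ StartsWith x u ∧ w ∈ lower x}.ncard

theorem termCoeff_coneFamily_ne_zero {u w x : AffineWeyl} {c m : ℤ}
    (hx : termCoeff (coneFamily u c) w m x ≠ 0) :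
    StartsWith x u ∧ w ∈ lower x ∧ m = 2 * len x + c := by
  rw [termCoeff, coneFamily] at hx
  split_ifs at hx with hlower hstarts
  · refine ⟨hstarts, hlower, ?_⟩
    by_contra hm
    exact hx (HahnSeries.coeff_single_of_ne (by omega))
  all_goals exact absurd rfl hx

theorem tCoeff_coneFamily (u w : AffineWeyl) (c : ℤ) (j : ℕ) :
    tCoeff (coneFamily u c) w (2 * j + c) = (-1) ^ j * coneCount u w j := by
  have hfinite : {x | len x = j ∧ StartsWith x u ∧ w ∈ lower x}.Finite :=
    (finite_setOf_len_le j).subset fun x hx => hx.1.le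
  rw [tCoeff_eq_finsum_termCoeff, finsum_eq_sum_of_support_subset (s := hfinite.toFinset),
    coneCount, Set.ncard_eq_toFinset_card _ hfinite, mul_comm ((-1) ^ j : ℤ), ← nsmul_eq_mul]
  · apply Finset.sum_eq_card_nsmul
    intro x hx
    obtain ⟨rfl, hstarts, hlower⟩ := hfinite.mem_toFinset.1 hx
    rw [termCoeff, if_pos hlower, coneFamily, if_pos hstarts,
      show (2 * len x + c - len x : ℤ) = len x + c by ring, HahnSeries.coeff_single_same]
  · intro x hx
    obtain ⟨hstarts, hlower, hm⟩ := termCoeff_coneFamily_ne_zero hx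
    rw [Set.Finite.coe_toFinset]
    exact ⟨by omega, hstarts, hlower⟩

theorem hasSum_tCoeff_coneFamily {u w : AffineWeyl} {v s : ℝ} (hv : v ≠ 0) (c : ℤ)
    (hs : HasSum (fun j : ℕ => (coneCount u w j : ℝ) * (-v ^ 2) ^ j) s) :
    HasSum (fun m : ℤ => (tCoeff (coneFamily u c) w m : ℝ) * v ^ m) (v ^ c * s) := by
  have hinj : Function.Injective fun j : ℕ => 2 * (j : ℤ) + c := fun i j hij => by
    dsimp only at hij
    omega
  rw [← hinj.hasSum_iff]
  · convert! hs.mul_left (v ^ c) using 2 with j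
    rw [Function.comp_apply, tCoeff_coneFamily, zpow_add₀ hv, _root_.zpow_mul, zpow_natCast,
      zpow_ofNat, neg_pow (v ^ 2)]
    push_cast
    ring
  · intro m hm
    rw [tCoeff_eq_finsum_termCoeff, finsum_eq_zero_of_forall_eq_zero, Int.cast_zero, zero_mul]
    intro x
    by_contra hx
    exact hm ⟨len x, (termCoeff_coneFamily_ne_zero hx).2.2.symm⟩

open scoped Classical in
/-- The least length of an element that starts with `u` and is above `w` in the Bruhat order. -/
def threshold (u w : AffineWeyl) : ℕ :=
  if StartsWith w u then len w else max (len u) (len w + 1)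

theorem len_le_threshold (u w : AffineWeyl) : len w ≤ threshold u w := by
  rw [threshold]
  split_ifs <;> omega

theorem coneCount_ray {σ : ℤˣ} {k : ℕ} (hk : 1 ≤ k) (w : AffineWeyl) (j : ℕ) :
    coneCount (ray σ k) w j = if threshold (ray σ k) w ≤ j then 1 else 0 := by
  have hcone (x : AffineWeyl) : (len x = j ∧ StartsWith x (ray σ k) ∧ w ∈ lower x) ↔
      x = ray σ j ∧ threshold (ray σ k) w ≤ j := by
    rw [threshold, startsWith_ray_iff hk, startsWith_ray_iff hk, mem_lower_iff,
      ← pos_injective.eq_iff, ← pos_injective.eq_iff, pos_ray, len_ray, len_eq_natAbs_pos,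
      len_eq_natAbs_pos]
    obtain rfl | rfl := Int.units_eq_one_or σ <;> simp <;> split_ifs <;> omega
  simp only [coneCount, hcone]
  split_ifs with h <;> simp [h]

theorem coneCount_one (w : AffineWeyl) (j : ℕ) :
    coneCount 1 w j = (if len w ≤ j then 1 else 0) + if len w + 1 ≤ j then 1 else 0 := by
  have hcone (x : AffineWeyl) : (len x = j ∧ StartsWith x 1 ∧ w ∈ lower x) ↔
      if len w < j then x = ray 1 j ∨ x = ray (-1) j else x = w ∧ len w = j := by
    simp only [startsWith_one_right, true_and, mem_lower_iff, ← pos_injective.eq_iff, pos_ray,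
      len_eq_natAbs_pos, Units.val_one, Units.val_neg]
    split_ifs <;> omega
  simp only [coneCount, hcone, Nat.add_one_le_iff]
  rcases lt_trichotomy (len w) j with h | h | h
  · have hne : ray 1 j ≠ ray (-1) j := by
      rw [Ne, ray_eq_ray_iff (by omega)]
      simp
    simp only [if_pos h.le, if_pos h]
    exact Set.ncard_pair hne
  · simp [h]
  · simp [h.not_gt, h.not_ge, h.ne']

theorem hasSum_ite_le_pow {𝕜 : Type*} [NormedField 𝕜] [CompleteSpace 𝕜] {r : 𝕜} (hr : ‖r‖ < 1)
    (J : ℕ) : HasSum (fun j : ℕ => if J ≤ j then r ^ j else 0) (r ^ J / (1 - r)) := by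
  have hinj : Function.Injective fun j : ℕ => j + J := add_left_injective J
  rw [← hinj.hasSum_iff, div_eq_mul_inv]
  · convert! (hasSum_geometric_of_norm_lt_one hr).mul_left (r ^ J) using 2 with j
    rw [Function.comp_apply, if_pos (Nat.le_add_left J j), pow_add, mul_comm]
  · exact fun j hj => if_neg fun hle => hj ⟨j - J, Nat.sub_add_cancel hle⟩

/-- The coefficient of `T_w` in `t_y`, evaluated at `v = q^{-1/2}`. -/
def valueT (v : ℝ) (y w : AffineWeyl) : ℝ :=
  if y = 1 then (-v ^ 2) ^ len w / (1 + v ^ 2) + (-v ^ 2) ^ (len w + 1) / (1 + v ^ 2)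
  else -∑ k ∈ Finset.Icc 1 (len y), v ^ ((len y : ℤ) + 1 - 2 * k) *
    ((-v ^ 2) ^ threshold (ray (direction y) k) w / (1 + v ^ 2))

theorem hasSum_tCoeff_preimageT {v : ℝ} (hv₀ : 0 < v) (hv₁ : v < 1) (y w : AffineWeyl) :
    HasSum (fun m : ℤ => (tCoeff (preimageT y) w m : ℝ) * v ^ m) (valueT v y w) := by
  have hgeom (J : ℕ) : HasSum (fun j : ℕ => if J ≤ j then (-v ^ 2) ^ j else 0)
      ((-v ^ 2) ^ J / (1 + v ^ 2)) := by
    rw [← sub_neg_eq_add]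
    refine hasSum_ite_le_pow ?_ J
    rw [norm_neg, norm_pow, Real.norm_of_nonneg hv₀.le]
    exact pow_lt_one₀ hv₀.le hv₁ two_ne_zero
  rw [preimageT, valueT]
  split_ifs with hy
  · rw [← one_mul (_ + _), ← zpow_zero v]
    refine hasSum_tCoeff_coneFamily hv₀.ne' 0 ?_
    convert! (hgeom (len w)).add (hgeom (len w + 1)) using 2 with j
    simp [coneCount_one, add_mul]
  · simp only [tCoeff_neg, tCoeff_sum _ fun _ _ => coneFamily_mem_nullFamilies _ _, Int.cast_neg,
      Int.cast_sum, neg_mul, Finset.sum_mul]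
    refine (hasSum_sum fun _ hk => hasSum_tCoeff_coneFamily hv₀.ne' _ ?_).neg
    convert! hgeom (threshold _ w) using 2 with j
    simp [coneCount_ray (Finset.mem_Icc.1 hk).1]

theorem exists_abs_valueT_le {v : ℝ} (hv₀ : 0 < v) (hv₁ : v < 1) (y : AffineWeyl) :
    ∃ C : ℝ, 0 ≤ C ∧ ∀ w, |valueT v y w| ≤ C * (v ^ 2) ^ len w := by
  have hterm {J : ℕ} {w : AffineWeyl} (hJ : len w ≤ J) :
      |(-v ^ 2) ^ J / (1 + v ^ 2)| ≤ (v ^ 2) ^ len w := by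
    rw [abs_div, abs_pow, abs_neg, abs_of_pos (show 0 < v ^ 2 by positivity),
      abs_of_pos (show 0 < 1 + v ^ 2 by positivity)]
    exact (div_le_self (by positivity) (le_add_of_nonneg_right (sq_nonneg v))).trans
      (pow_le_pow_of_le_one (by positivity) (pow_le_one₀ hv₀.le hv₁.le) hJ)
  simp only [valueT]
  split_ifs
  · refine ⟨2, zero_le_two, fun w => ?_⟩
    rw [two_mul]
    exact (abs_add_le _ _).trans (add_le_add (hterm le_rfl) (hterm (Nat.le_succ _)))
  · refine ⟨∑ k ∈ Finset.Icc 1 (len y), v ^ ((len y : ℤ) + 1 - 2 * k),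
      Finset.sum_nonneg fun k _ => (zpow_pos hv₀ _).le, fun w => ?_⟩
    rw [abs_neg, Finset.sum_mul]
    refine (Finset.abs_sum_le_sum_abs _ _).trans (Finset.sum_le_sum fun k _ => ?_)
    rw [abs_mul, abs_of_pos (zpow_pos hv₀ _)]
    exact mul_le_mul_of_nonneg_left (hterm (len_le_threshold _ w)) (zpow_pos hv₀ _).le

theorem inv_sqrt_zpow_eq {q : ℝ} (hq : 0 < q) {n : ℕ} (hn : 1 ≤ n) (k : ℤ) :
    (√q)⁻¹ ^ ((n : ℤ) + 1 - 2 * k) = √q ^ (n - 1) * q ^ (k - n) := by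
  have hsq : q ^ (k - n) = √q ^ (2 * (k - n)) := by
    rw [_root_.zpow_mul, zpow_ofNat, Real.sq_sqrt hq.le]
  rw [hsq, ← zpow_natCast, ← zpow_add₀ (Real.sqrt_pos.2 hq).ne', _root_.inv_zpow', Nat.cast_sub hn]
  congr 1
  push_cast
  ring

theorem neg_inv_pow_div_one_add_inv {𝕜 : Type*} [Field 𝕜] {q : 𝕜} (hq : q ≠ 0) (J : ℕ) :
    (-q⁻¹) ^ J / (1 + q⁻¹) = (-1) ^ J * q ^ (-(J : ℤ) + 1) / (1 + q) := by
  have hden : 1 + q⁻¹ = (1 + q) * q⁻¹ := by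
    rw [add_mul, one_mul, mul_inv_cancel₀ hq, add_comm]
  rw [hden, zpow_add₀ hq, _root_.zpow_neg, zpow_natCast, zpow_one, neg_pow, inv_pow,
    div_mul_eq_div_div, div_inv_eq_mul]
  ring

theorem valueT_eq_explicitCoeff {q : ℝ} (hq : 0 < q) {y : AffineWeyl} (hy : y ≠ 1)
    (w : AffineWeyl) : valueT (√q)⁻¹ y w = explicitCoeff q y w := by
  have hlen : 1 ≤ len y := Nat.one_le_iff_ne_zero.2 (len_eq_zero.not.2 hy)
  rw [valueT, explicitCoeff, if_neg hy, neg_mul, Finset.mul_sum, neg_inj]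
  refine Finset.sum_congr rfl fun k hk => ?_
  rw [inv_sqrt_zpow_eq hq hlen, mul_assoc, inv_pow, Real.sq_sqrt hq.le,
    neg_inv_pow_div_one_add_inv hq.ne', wordProd_take_redWord (Finset.mem_Icc.1 hk).2, threshold,
    len_ray]
  congr 2
  split_ifs with hstarts hle
  · rfl
  · rw [max_eq_right (by omega), Nat.cast_succ, neg_add, neg_add_cancel_right]
  · rw [max_eq_left (by omega)]

/-! ### Matrices and the Iwahori subgroup -/

section Matrices

variable {F : Type*} [Field F]

theorem coe_torus (u : Fˣ) :
    (torus u : Matrix (Fin 2) (Fin 2) F) = !![(u : F), 0; 0, (u : F)⁻¹] := by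
  simp [torus]

theorem coe_weylElt : ((weylElt : SL(2, F)) : Matrix (Fin 2) (Fin 2) F) = !![0, -1; 1, 0] :=
  rfl

theorem coe_lift_r (ϖ : Fˣ) (n : ℤ) :
    (lift ϖ (.r n) : Matrix (Fin 2) (Fin 2) F) = !![(ϖ : F) ^ n, 0; 0, ((ϖ : F) ^ n)⁻¹] := by
  simp [lift, coe_torus]

theorem coe_lift_sr (ϖ : Fˣ) (n : ℤ) :
    (lift ϖ (.sr n) : Matrix (Fin 2) (Fin 2) F) = !![0, -((ϖ : F) ^ n)⁻¹; (ϖ : F) ^ n, 0] := by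
  simp [lift, coe_torus, coe_weylElt]

theorem torus_mul (u v : Fˣ) : torus (u * v) = torus u * torus v := by
  refine Subtype.coe_injective ?_
  simp [coe_torus, mul_comm]

theorem weylElt_mul_torus (u : Fˣ) : weylElt * torus u = torus u⁻¹ * weylElt := by
  refine Subtype.coe_injective ?_
  simp [coe_weylElt, coe_torus]

theorem det_fin_two_eq_one (g : SL(2, F)) : g 0 0 * g 1 1 - g 0 1 * g 1 0 = 1 :=
  (det_fin_two _).symm.trans g.2

theorem exists_eq_torus {g : SL(2, F)} (h₀₁ : g 0 1 = 0) (h₁₀ : g 1 0 = 0) :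
    ∃ u, g = torus u := by
  have hdet : g 0 0 * g 1 1 = 1 := by linear_combination det_fin_two_eq_one g + h₀₁ * g 1 0
  refine ⟨⟨g 0 0, g 1 1, hdet, by rw [mul_comm, hdet]⟩, ?_⟩
  ext i j
  fin_cases i <;> fin_cases j
  exacts [rfl, h₀₁, h₁₀, rfl]

theorem exists_eq_weylElt_mul_torus {g : SL(2, F)} (h₀₀ : g 0 0 = 0) (h₁₁ : g 1 1 = 0) :
    ∃ u, g = weylElt * torus u := by
  simp only [← inv_mul_eq_iff_eq_mul]
  apply exists_eq_torus <;> simp [coe_weylElt, mul_apply, adjugate_fin_two, h₀₀, h₁₁]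

theorem apply_ne_zero_of_forall {ι : Type*} [Fintype ι] [DecidableEq ι] (g : SpecialLinearGroup ι F)
    {i j : ι} (h : g i j = 0 → ∀ k, g k j = 0) : g i j ≠ 0 := fun h₀ => by
  simpa [det_eq_zero_of_column_eq_zero j (h h₀)] using g.2

/-- Clearing a row and a column with the pivot `g i j`. -/
theorem transvection_mul_mul_transvection_apply {ι : Type*} [Fintype ι] [DecidableEq ι]
    (g : SpecialLinearGroup ι F) {i i' j j' : ι} (hi : i' ≠ i) (hj : j ≠ j') (hg : g i j ≠ 0) :
    let h := SpecialLinearGroup.transvection hi (-(g i' j / g i j)) * g *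
      SpecialLinearGroup.transvection hj (-(g i j' / g i j))
    h i' j = 0 ∧ h i j' = 0 := by
  intro h
  have hcoe : h.1 = transvection i' i (-(g i' j / g i j)) * g *
    transvection j j' (-(g i j' / g i j)) := rfl
  constructor
  · rw [hcoe, mul_transvection_apply_of_ne _ _ _ _ hj, transvection_mul_apply_same]
    field_simp
    ring
  · rw [hcoe, mul_assoc, transvection_mul_apply_of_ne _ _ _ _ hi.symm, mul_transvection_apply_same]
    field_simp
    ring

end Matrices

section Group

variable {F : Type*} [Field F] [ValuativeRel F]

theorem mem_maxCompact_iff {g : SL(2, F)} :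
    g ∈ maxCompact F ↔ ∀ i j, valuation F (g i j) ≤ 1 := by
  refine ⟨?_, fun h => ?_⟩
  · rintro ⟨k, rfl⟩ i j
    exact (k i j).2
  · let A : Matrix (Fin 2) (Fin 2) 𝒪[F] := fun i j => ⟨g i j, h i j⟩
    have hA : algebraMap 𝒪[F] F A.det = 1 := (RingHom.map_det _ A).trans g.2
    exact ⟨⟨A, Subtype.coe_injective hA⟩, rfl⟩

theorem mem_maximalIdeal_iff {x : 𝒪[F]} : x ∈ 𝓂[F] ↔ valuation F (x : F) < 1 := by
  rw [IsLocalRing.mem_maximalIdeal, mem_nonunits_iff,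
    (Valuation.integer.integers (valuation F)).isUnit_iff_valuation_eq_one]
  exact (lt_iff_le_and_ne.trans (and_iff_right x.2)).symm

theorem mem_iwahori_iff {g : SL(2, F)} :
    g ∈ iwahori F ↔ g ∈ maxCompact F ∧ valuation F (g 1 0) < 1 := by
  constructor
  · rintro ⟨k, hk, rfl⟩
    exact ⟨⟨k, rfl⟩, mem_maximalIdeal_iff.1 hk⟩
  · rintro ⟨⟨k, rfl⟩, hk⟩
    exact ⟨k, mem_maximalIdeal_iff.2 hk, rfl⟩

theorem valuation_le_one_of_mem_iwahori {g : SL(2, F)} (hg : g ∈ iwahori F) (i j : Fin 2) :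
    valuation F (g i j) ≤ 1 :=
  mem_maxCompact_iff.1 (mem_iwahori_iff.1 hg).1 i j

theorem valuation_diag_of_mem_iwahori {g : SL(2, F)} (hg : g ∈ iwahori F) (i : Fin 2) :
    valuation F (g i i) = 1 := by
  have hle := valuation_le_one_of_mem_iwahori hg
  have hoff : valuation F (g 0 1 * g 1 0) < 1 := by
    rw [map_mul]
    exact (mul_le_of_le_one_left' (hle 0 1)).trans_lt (mem_iwahori_iff.1 hg).2
  have hdiag : valuation F (g 0 0) * valuation F (g 1 1) = 1 := by
    rw [← map_mul, show g 0 0 * g 1 1 = 1 + g 0 1 * g 1 0 by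
      linear_combination det_fin_two_eq_one g]
    exact Valuation.map_one_add_of_lt _ hoff
  fin_cases i
  · exact eq_one_of_one_le_mul_left (hle 0 0) (hle 1 1) hdiag.ge
  · exact eq_one_of_one_le_mul_right (hle 0 0) (hle 1 1) hdiag.ge

theorem transvection_mem_iwahori {i j : Fin 2} (hij : i ≠ j) {x : F} (hx : valuation F x ≤ 1)
    (hx' : j < i → valuation F x < 1) : SpecialLinearGroup.transvection hij x ∈ iwahori F := by
  rw [mem_iwahori_iff, mem_maxCompact_iff]
  obtain ⟨rfl, rfl⟩ | ⟨rfl, rfl⟩ : i = 0 ∧ j = 1 ∨ i = 1 ∧ j = 0 := by lia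
  · simpa [Fin.forall_fin_two, SpecialLinearGroup.transvection, transvection] using hx
  · simpa [Fin.forall_fin_two, SpecialLinearGroup.transvection, transvection, hx] using hx'

theorem torus_mem_iwahori {u : Fˣ} (hu : valuation F (u : F) = 1) : torus u ∈ iwahori F := by
  simp [mem_iwahori_iff, mem_maxCompact_iff, Fin.forall_fin_two, coe_torus, hu]

theorem mem_iwahoriCell_iff {ϖ : Fˣ} {w : AffineWeyl} {g : SL(2, F)} :
    g ∈ iwahoriCell ϖ w ↔ ∃ k ∈ iwahori F, ∃ k' ∈ iwahori F, g = k * lift ϖ w * k' :=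
  DoubleCoset.mem_doubleCoset

theorem mul_mem_iwahoriCell {ϖ : Fˣ} {w : AffineWeyl} {u v g : SL(2, F)} (hu : u ∈ iwahori F)
    (hv : v ∈ iwahori F) (hg : g ∈ iwahoriCell ϖ w) : u * g * v ∈ iwahoriCell ϖ w := by
  obtain ⟨k, hk, k', hk', rfl⟩ := mem_iwahoriCell_iff.1 hg
  exact mem_iwahoriCell_iff.2 ⟨u * k, mul_mem hu hk, k' * v, mul_mem hk' hv, by group⟩

theorem valuation_uniformizer_lt_one {ϖ : Fˣ} (hϖ : IsUniformizer ϖ) : valuation F (ϖ : F) < 1 :=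
  (Valuation.integer.integers (valuation F)).valuation_irreducible_lt_one hϖ.choose_spec

theorem valuation_unit_pos (u : Fˣ) : 0 < valuation F (u : F) :=
  zero_lt_iff.2 ((valuation F).ne_zero_iff.2 u.ne_zero)

/-! ### The decomposition of `SL₂(F)` into Iwahori double cosets -/

theorem mul_lift_sr_ne {ϖ : Fˣ} {k k' : SL(2, F)} (hk : k ∈ iwahori F)
    (hk' : k' ∈ iwahori F) (m n : ℤ) : k * lift ϖ (.sr m) ≠ lift ϖ (.r n) * k' := by
  intro h
  have hpos (l : ℤ) : 0 < valuation F (ϖ : F) ^ l := zpow_pos (valuation_unit_pos ϖ) l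
  have h₀₀ : valuation F (k 0 1) * valuation F (ϖ : F) ^ m = valuation F (ϖ : F) ^ n := by
    simpa [mul_apply, coe_lift_r, coe_lift_sr, valuation_diag_of_mem_iwahori hk']
      using congrArg (fun g : SL(2, F) => valuation F (g 0 0)) h
  have h₁₁ : valuation F (k 1 0) * (valuation F (ϖ : F) ^ m)⁻¹ = (valuation F (ϖ : F) ^ n)⁻¹ := by
    simpa [mul_apply, coe_lift_r, coe_lift_sr, valuation_diag_of_mem_iwahori hk']
      using congrArg (fun g : SL(2, F) => valuation F (g 1 1)) h
  have hle : valuation F (ϖ : F) ^ n ≤ valuation F (ϖ : F) ^ m := by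
    rw [← h₀₀]
    exact mul_le_of_le_one_left' (valuation_le_one_of_mem_iwahori hk 0 1)
  have hlt : (valuation F (ϖ : F) ^ n)⁻¹ < (valuation F (ϖ : F) ^ m)⁻¹ := by
    rw [← h₁₁]
    exact mul_lt_of_lt_one_left (inv_pos.2 (hpos m)) (mem_iwahori_iff.1 hk).2
  exact hle.not_gt ((inv_lt_inv₀ (hpos n) (hpos m)).1 hlt)

theorem eq_of_mul_lift_eq {ϖ : Fˣ} (hϖ : IsUniformizer ϖ) {k k' : SL(2, F)} (hk : k ∈ iwahori F)
    (hk' : k' ∈ iwahori F) {w w' : AffineWeyl} (h : k * lift ϖ w' = lift ϖ w * k') : w = w' := by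
  have hinj : Function.Injective fun n : ℤ => valuation F (ϖ : F) ^ n :=
    zpow_right_injective₀ (valuation_unit_pos ϖ) (valuation_uniformizer_lt_one hϖ).ne
  obtain ⟨n, rfl⟩ | ⟨n, rfl⟩ := exists_eq_r_or_sr w <;>
    obtain ⟨m, rfl⟩ | ⟨m, rfl⟩ := exists_eq_r_or_sr w'
  · have h₀₀ : valuation F (ϖ : F) ^ m = valuation F (ϖ : F) ^ n := by
      simpa [mul_apply, coe_lift_r, valuation_diag_of_mem_iwahori, hk, hk']
        using congrArg (fun g : SL(2, F) => valuation F (g 0 0)) h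
    rw [hinj h₀₀]
  · exact absurd h (mul_lift_sr_ne hk hk' m n)
  · refine absurd ?_ (mul_lift_sr_ne (ϖ := ϖ) (inv_mem hk) (inv_mem hk') n m)
    rw [eq_mul_inv_iff_mul_eq, mul_assoc, ← h, inv_mul_cancel_left]
  · have h₁₀ : valuation F (ϖ : F) ^ m = valuation F (ϖ : F) ^ n := by
      simpa [mul_apply, coe_lift_sr, valuation_diag_of_mem_iwahori, hk, hk']
        using congrArg (fun g : SL(2, F) => valuation F (g 1 0)) h
    rw [hinj h₁₀]

theorem eq_of_mem_iwahoriCell {ϖ : Fˣ} (hϖ : IsUniformizer ϖ) {g : SL(2, F)} {w w' : AffineWeyl}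
    (h : g ∈ iwahoriCell ϖ w) (h' : g ∈ iwahoriCell ϖ w') : w = w' := by
  obtain ⟨k, hk, k', hk', rfl⟩ := mem_iwahoriCell_iff.1 h
  obtain ⟨l, hl, l', hl', heq⟩ := mem_iwahoriCell_iff.1 h'
  refine eq_of_mul_lift_eq hϖ (mul_mem (inv_mem hk) hl) (mul_mem hk' (inv_mem hl')) ?_
  rw [mul_assoc, inv_mul_eq_iff_eq_mul, ← mul_assoc, ← mul_assoc, eq_mul_inv_iff_mul_eq, heq]

variable [IsDiscreteValuationRing 𝒪[F]]

theorem exists_eq_zpow_mul {ϖ : Fˣ} (hϖ : IsUniformizer ϖ) (x : Fˣ) :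
    ∃ (n : ℤ) (u : Fˣ), valuation F (u : F) = 1 ∧ x = ϖ ^ n * u := by
  obtain ⟨h, hirr⟩ := hϖ
  obtain ⟨n, u, hu⟩ :=
    IsDiscreteValuationRing.exists_units_eq_smul_zpow_of_irreducible hirr x.ne_zero
  refine ⟨n, Units.map (algebraMap 𝒪[F] F).toMonoidHom u,
    (Valuation.integer.integers (valuation F)).valuation_unit u, Units.ext ?_⟩
  simp only [hu, Units.smul_def, Algebra.smul_def, Units.val_mul, Units.val_zpow_eq_zpow_val]
  exact mul_comm _ _

theorem exists_mem_iwahoriCell_of_diagonal {ϖ : Fˣ} (hϖ : IsUniformizer ϖ) {g : SL(2, F)}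
    (h₀₁ : g 0 1 = 0) (h₁₀ : g 1 0 = 0) : ∃ w, g ∈ iwahoriCell ϖ w := by
  obtain ⟨x, rfl⟩ := exists_eq_torus h₀₁ h₁₀
  obtain ⟨n, u, hu, rfl⟩ := exists_eq_zpow_mul hϖ x
  refine ⟨.r n, mem_iwahoriCell_iff.2 ⟨1, one_mem _, torus u, torus_mem_iwahori hu, ?_⟩⟩
  rw [one_mul]
  exact torus_mul _ _

theorem exists_mem_iwahoriCell_of_antidiagonal {ϖ : Fˣ} (hϖ : IsUniformizer ϖ) {g : SL(2, F)}
    (h₀₀ : g 0 0 = 0) (h₁₁ : g 1 1 = 0) : ∃ w, g ∈ iwahoriCell ϖ w := by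
  obtain ⟨x, rfl⟩ := exists_eq_weylElt_mul_torus h₀₀ h₁₁
  obtain ⟨n, u, hu, rfl⟩ := exists_eq_zpow_mul hϖ x
  refine ⟨.sr n, mem_iwahoriCell_iff.2 ⟨1, one_mem _, torus u, torus_mem_iwahori hu, ?_⟩⟩
  rw [one_mul, torus_mul, ← mul_assoc]
  rfl

theorem exists_mem_iwahoriCell_of_pivot {ϖ : Fˣ} (hϖ : IsUniformizer ϖ) {g : SL(2, F)}
    {i i' j j' : Fin 2} (hi : i' ≠ i) (hj : j ≠ j')
    (hcol : valuation F (g i' j) ≤ valuation F (g i j))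
    (hcol' : i < i' → valuation F (g i' j) < valuation F (g i j))
    (hrow : valuation F (g i j') ≤ valuation F (g i j))
    (hrow' : j' < j → valuation F (g i j') < valuation F (g i j)) :
    ∃ w, g ∈ iwahoriCell ϖ w := by
  have hg : g i j ≠ 0 := apply_ne_zero_of_forall g fun h₀ k => by
    obtain rfl | rfl : k = i ∨ k = i' := by omega
    · exact h₀
    · simpa [h₀] using hcol
  have hpos : 0 < valuation F (g i j) := zero_lt_iff.2 ((valuation F).ne_zero_iff.2 hg)
  have hk : SpecialLinearGroup.transvection hi (-(g i' j / g i j)) ∈ iwahori F :=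
    transvection_mem_iwahori hi (by simpa using div_le_one_of_le₀ hcol zero_le)
      fun h => by simpa using (div_lt_one₀ hpos).2 (hcol' h)
  have hk' : SpecialLinearGroup.transvection hj (-(g i j' / g i j)) ∈ iwahori F :=
    transvection_mem_iwahori hj (by simpa using div_le_one_of_le₀ hrow zero_le)
      fun h => by simpa using (div_lt_one₀ hpos).2 (hrow' h)
  obtain ⟨h₁, h₂⟩ := transvection_mul_mul_transvection_apply g hi hj hg
  set h := SpecialLinearGroup.transvection hi (-(g i' j / g i j)) * g *
      SpecialLinearGroup.transvection hj (-(g i j' / g i j)) with h_def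
  obtain ⟨w, hw⟩ : ∃ w, h ∈ iwahoriCell ϖ w := by
    fin_cases i <;> fin_cases i' <;> fin_cases j <;> fin_cases j' <;> try contradiction
    · exact exists_mem_iwahoriCell_of_diagonal hϖ h₂ h₁
    · exact exists_mem_iwahoriCell_of_antidiagonal hϖ h₂ h₁
    · exact exists_mem_iwahoriCell_of_antidiagonal hϖ h₁ h₂
    · exact exists_mem_iwahoriCell_of_diagonal hϖ h₁ h₂
  refine ⟨w, ?_⟩
  rw [show g = _⁻¹ * h * _⁻¹ by
    rw [h_def, mul_assoc _ g, inv_mul_cancel_left, mul_inv_cancel_right]]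
  exact mul_mem_iwahoriCell (inv_mem hk) (inv_mem hk') hw

theorem exists_mem_iwahoriCell {ϖ : Fˣ} (hϖ : IsUniformizer ϖ) (g : SL(2, F)) :
    ∃ w, g ∈ iwahoriCell ϖ w := by
  have hpivot : ∀ a b c d : ValueGroupWithZero F,
      (c < a ∧ b ≤ a) ∨ (b ≤ d ∧ c < d) ∨ (a ≤ c ∧ d ≤ c) ∨ (d < b ∧ a < b) := by
    intro a b c d
    grind
  rcases hpivot (valuation F (g 0 0)) (valuation F (g 0 1)) (valuation F (g 1 0))
    (valuation F (g 1 1)) with ⟨h, h'⟩ | ⟨h, h'⟩ | ⟨h, h'⟩ | ⟨h, h'⟩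
  · exact exists_mem_iwahoriCell_of_pivot hϖ (i := 0) (i' := 1) (j := 0) (j' := 1)
      (by decide) (by decide) h.le (fun _ => h) h' (by simp)
  · exact exists_mem_iwahoriCell_of_pivot hϖ (i := 1) (i' := 0) (j := 1) (j' := 0)
      (by decide) (by decide) h (by simp) h'.le (fun _ => h')
  · exact exists_mem_iwahoriCell_of_pivot hϖ (i := 1) (i' := 0) (j := 0) (j' := 1)
      (by decide) (by decide) h (by simp) h' (by simp)
  · exact exists_mem_iwahoriCell_of_pivot hϖ (i := 0) (i' := 1) (j := 1) (j' := 0)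
      (by decide) (by decide) h.le (fun _ => h) h'.le (fun _ => h')

end Group

/-! ### The Schwartz space -/

section Growth

theorem exists_forall_rpow_le_mul_pow {q : ℝ} (hq : 1 < q) (m : ℝ) :
    ∃ C, 0 ≤ C ∧ ∀ n : ℕ, (n : ℝ) ^ m ≤ C * q ^ n := by
  have hexp (n : ℕ) : Real.exp (-Real.log q * n) = (q ^ n)⁻¹ := by
    rw [neg_mul, Real.exp_neg, mul_comm, Real.exp_nat_mul, Real.exp_log (zero_lt_one.trans hq)]
  obtain ⟨C, hC⟩ := ((tendsto_rpow_mul_exp_neg_mul_atTop_nhds_zero m _ (Real.log_pos hq)).comp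
    tendsto_natCast_atTop_atTop).bddAbove_range
  have hle (n : ℕ) : (n : ℝ) ^ m ≤ C * q ^ n := by
    have := hC ⟨n, rfl⟩
    rwa [Function.comp_apply, hexp, ← div_eq_mul_inv,
      div_le_iff₀ (pow_pos (zero_lt_one.trans hq) n)] at this
  exact ⟨C, by simpa using (Real.rpow_nonneg le_rfl m).trans (by simpa using hle 0), hle⟩

theorem coe_toNNReal_of_ne_zero {e : NNReal} (he : e ≠ 0) {x : WithZero (Multiplicative ℤ)}
    (hx : x ≠ 0) : (WithZeroMulInt.toNNReal he x : ℝ) = (e : ℝ) ^ WithZero.log x := by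
  rw [WithZeroMulInt.toNNReal_neg_apply he hx, NNReal.coe_zpow]
  conv_rhs => rw [← WithZero.coe_unzero hx]
  rfl

theorem exists_valuation_eval_le {R Γ₀ σ : Type*} [CommRing R]
    [LinearOrderedCommGroupWithZero Γ₀] (v : Valuation R Γ₀) (p : MvPolynomial σ R) :
    ∃ (C : Γ₀) (D : ℕ), ∀ r, 1 ≤ r → ∀ e : σ → R, (∀ i, v (e i) ≤ r) →
      v (MvPolynomial.eval e p) ≤ C * r ^ D := by
  induction p using MvPolynomial.induction_on with
  | C a => exact ⟨v a, 0, fun r _ e _ => by simp⟩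
  | add p p' hp hp' =>
    obtain ⟨C, D, h⟩ := hp
    obtain ⟨C', D', h'⟩ := hp'
    refine ⟨max C C', max D D', fun r hr e he => ?_⟩
    rw [map_add]
    refine v.map_add_le ((h r hr e he).trans ?_) ((h' r hr e he).trans ?_)
    · exact mul_le_mul' (le_max_left _ _) (pow_le_pow_right₀ hr (le_max_left _ _))
    · exact mul_le_mul' (le_max_right _ _) (pow_le_pow_right₀ hr (le_max_right _ _))
  | mul_X p i hp =>
    obtain ⟨C, D, h⟩ := hp
    refine ⟨C, D + 1, fun r hr e he => ?_⟩
    rw [map_mul (MvPolynomial.eval e), MvPolynomial.eval_X, map_mul, pow_succ, ← mul_assoc]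
    exact mul_le_mul' (h r hr e he) (he i)

theorem valuation_mul_apply_le {R Γ₀ l m n : Type*} [Ring R] [LinearOrderedCommMonoidWithZero Γ₀]
    [Fintype m] (v : Valuation R Γ₀) {A : Matrix l m R} {B : Matrix m n R} {a b : Γ₀}
    (hA : ∀ i k, v (A i k) ≤ a) (hB : ∀ k j, v (B k j) ≤ b) (i : l) (j : n) :
    v ((A * B) i j) ≤ a * b :=
  v.map_sum_le fun k _ => (v.map_mul _ _).trans_le (mul_le_mul' (hA i k) (hB k j))

end Growth

section Cartan

variable {F : Type*} [Field F] [ValuativeRel F]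

theorem weylElt_mem_maxCompact : weylElt ∈ maxCompact F := by
  simp [mem_maxCompact_iff, Fin.forall_fin_two, coe_weylElt]

theorem torus_zpow_mem_doubleCoset (ϖ : Fˣ) (n : ℤ) :
    torus (ϖ ^ n) ∈ DoubleCoset.doubleCoset (torus (ϖ ^ n.natAbs)) (maxCompact F : Set SL(2, F))
      (maxCompact F) := by
  rw [DoubleCoset.mem_doubleCoset]
  obtain ⟨m, rfl | rfl⟩ := n.eq_nat_or_neg
  · exact ⟨1, one_mem _, 1, one_mem _, by simp⟩
  · refine ⟨weylElt, weylElt_mem_maxCompact, weylElt⁻¹, inv_mem weylElt_mem_maxCompact, ?_⟩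
    simp [weylElt_mul_torus]

theorem exists_mem_doubleCoset_of_mem_iwahoriCell {ϖ : Fˣ} {w : AffineWeyl} {g : SL(2, F)}
    (hg : g ∈ iwahoriCell ϖ w) : ∃ n : ℕ, 2 * n ≤ len w + 1 ∧
      g ∈ DoubleCoset.doubleCoset (torus (ϖ ^ n)) (maxCompact F : Set SL(2, F)) (maxCompact F) := by
  obtain ⟨n, k, hk, hn, hw⟩ : ∃ n : ℤ, ∃ k ∈ maxCompact F,
      2 * n.natAbs ≤ len w + 1 ∧ lift ϖ w = k * torus (ϖ ^ n) := by
    obtain ⟨n, rfl⟩ | ⟨n, rfl⟩ := exists_eq_r_or_sr w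
    · refine ⟨n, 1, one_mem _, ?_, (one_mul _).symm⟩
      rw [len_eq_natAbs_pos, pos_r]
      lia
    · refine ⟨n, weylElt, weylElt_mem_maxCompact, ?_, rfl⟩
      rw [len_eq_natAbs_pos, pos_sr]
      lia
  obtain ⟨a, ha, b, hb, rfl⟩ := mem_iwahoriCell_iff.1 hg
  obtain ⟨c, hc, d, hd, htorus⟩ := DoubleCoset.mem_doubleCoset.1 (torus_zpow_mem_doubleCoset ϖ n)
  refine ⟨n.natAbs, hn, DoubleCoset.mem_doubleCoset.2 ⟨a * k * c,
    mul_mem (mul_mem (mem_iwahori_iff.1 ha).1 hk) hc, d * b,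
    mul_mem hd (mem_iwahori_iff.1 hb).1, ?_⟩⟩
  rw [hw, htorus]
  group

theorem valuation_apply_le_of_mem_doubleCoset {ϖ : Fˣ} (hϖ : IsUniformizer ϖ) {n : ℕ} {g : SL(2, F)}
    (hg : g ∈
      DoubleCoset.doubleCoset (torus (ϖ ^ n)) (maxCompact F : Set SL(2, F)) (maxCompact F))
    (i j : Fin 2) : valuation F (g i j) ≤ valuation F ((ϖ : F)⁻¹ ^ n) := by
  obtain ⟨k, hk, k', hk', rfl⟩ := DoubleCoset.mem_doubleCoset.1 hg
  have htorus (i j : Fin 2) :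
      valuation F (torus (ϖ ^ n) i j) ≤ valuation F ((ϖ : F)⁻¹ ^ n) := by
    have hle : valuation F (ϖ : F) ^ n ≤ 1 :=
      pow_le_one₀ zero_le (valuation_uniformizer_lt_one hϖ).le
    have hge : 1 ≤ (valuation F (ϖ : F) ^ n)⁻¹ :=
      (one_le_inv₀ (pow_pos (valuation_unit_pos ϖ) n)).2 hle
    fin_cases i <;> fin_cases j <;> simp [coe_torus, hle.trans hge]
  refine (valuation_mul_apply_le (valuation F) (valuation_mul_apply_le (valuation F)
    (mem_maxCompact_iff.1 hk) htorus) (mem_maxCompact_iff.1 hk') i j).trans_eq ?_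
  rw [one_mul, mul_one]

end Cartan

theorem continuous_apply_apply {F n : Type*} [CommRing F] [TopologicalSpace F] [Fintype n]
    [DecidableEq n] (i j : n) : Continuous fun g : SpecialLinearGroup n F => g i j :=
  continuous_subtype_val.matrix_elem i j

section LocalField

variable {F : Type*} [Field F] [ValuativeRel F] [TopologicalSpace F] [IsNonarchimedeanLocalField F]

variable (F) in
theorem one_lt_resCard : 1 < resCard F :=
  Finite.one_lt_card

variable (F) in
/-- The normalized absolute value `absF` as a valuation; see `absF_eq`. -/
def normValuation : Valuation F NNReal :=
  (valuation F).map
    ((WithZeroMulInt.toNNReal (e := resCard F)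
      (Nat.cast_ne_zero.2 (zero_lt_one.trans (one_lt_resCard F)).ne')).comp
      (.ofClass (IsNonarchimedeanLocalField.valueGroupWithZeroIsoInt F)))
    ((WithZeroMulInt.toNNReal_strictMono (Nat.one_lt_cast.2 (one_lt_resCard F))).monotone.comp
      (OrderHomClass.mono (IsNonarchimedeanLocalField.valueGroupWithZeroIsoInt F)))

theorem absF_eq (x : F) : absF x = normValuation F x := by
  obtain rfl | hx := eq_or_ne x 0
  · simp [absF]
  · have hiso : IsNonarchimedeanLocalField.valueGroupWithZeroIsoInt F (valuation F x) ≠ 0 :=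
      (map_ne_zero _).2 ((valuation F).ne_zero_iff.2 hx)
    rw [absF, if_neg hx, ← NNReal.coe_natCast]
    exact (coe_toNNReal_of_ne_zero
      (Nat.cast_ne_zero.2 (zero_lt_one.trans (one_lt_resCard F)).ne') hiso).symm

theorem normValuation_le_normValuation {x y : F} (h : valuation F x ≤ valuation F y) :
    normValuation F x ≤ normValuation F y :=
  (WithZeroMulInt.toNNReal_strictMono (Nat.one_lt_cast.2 (one_lt_resCard F))).monotone
    (OrderHomClass.mono (IsNonarchimedeanLocalField.valueGroupWithZeroIsoInt F) h)

theorem exists_log_one_add_absF_le {ϖ : Fˣ} (hϖ : IsUniformizer ϖ)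
    (p : MvPolynomial (Fin 2 × Fin 2) F) :
    ∃ A, 0 ≤ A ∧ ∀ (n : ℕ) (g : SL(2, F)),
      g ∈ DoubleCoset.doubleCoset (torus (ϖ ^ n)) (maxCompact F : Set SL(2, F)) (maxCompact F) →
      Real.log (1 + absF (polyFun p g)) ≤ A * (n + 1) := by
  obtain ⟨C, D, hp⟩ := exists_valuation_eval_le (normValuation F) p
  set M := normValuation F (ϖ : F)⁻¹ with M_def
  have hM : 1 ≤ M := by
    rw [← map_one (normValuation F)]
    refine normValuation_le_normValuation ?_
    rw [map_one, map_inv₀]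
    exact (one_le_inv₀ (valuation_unit_pos ϖ)).2 (valuation_uniformizer_lt_one hϖ).le
  have hlogM : 0 ≤ Real.log M := Real.log_nonneg hM
  have hlogC : 0 ≤ Real.log (1 + C) := Real.log_nonneg (le_add_of_nonneg_right C.2)
  refine ⟨Real.log (1 + C) + D * Real.log M, by positivity, fun n g hg => ?_⟩
  have hentry (ij : Fin 2 × Fin 2) : normValuation F (g ij.1 ij.2) ≤ M ^ n := by
    rw [M_def, ← map_pow]
    exact normValuation_le_normValuation (valuation_apply_le_of_mem_doubleCoset hϖ hg _ _)
  have hvalue : absF (polyFun p g) ≤ C * (M ^ n) ^ D := by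
    rw [absF_eq]
    exact_mod_cast hp _ (one_le_pow₀ hM) _ hentry
  calc Real.log (1 + absF (polyFun p g))
      ≤ Real.log ((1 + C) * (M ^ n) ^ D) := by
        refine Real.log_le_log ?_ ?_
        · rw [absF_eq]
          positivity
        · have : (1 : ℝ) ≤ (M ^ n) ^ D := one_le_pow₀ (one_le_pow₀ hM)
          linarith
    _ = Real.log (1 + C) + D * n * Real.log M := by
        have : (M : ℝ) ≠ 0 := (zero_lt_one.trans_le (NNReal.coe_le_coe.2 hM)).ne'
        rw [Real.log_mul (by positivity) (by positivity), Real.log_pow, Real.log_pow, mul_assoc]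
    _ ≤ (Real.log (1 + C) + D * Real.log M) * (n + 1) := by
        have : 0 ≤ Real.log (1 + C) * n + D * Real.log M := by positivity
        linarith

variable (F) in
theorem isClopen_valuation_lt_one : IsClopen {x : F | valuation F x < 1} := by
  simpa only [Valuation.restrict_lt_one_iff] using (valuation F).isClopen_ball 1

variable (F) in
theorem isClopen_iwahori : IsClopen (iwahori F : Set SL(2, F)) := by
  have hiwahori : (iwahori F : Set SL(2, F)) =
      (⋂ i, ⋂ j, (fun g : SL(2, F) => g i j) ⁻¹' 𝒪[F]) ∩
        (fun g : SL(2, F) => g 1 0) ⁻¹' {x | valuation F x < 1} := by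
    ext g
    simp only [SetLike.mem_coe, mem_iwahori_iff, mem_maxCompact_iff, Set.mem_inter_iff,
      Set.mem_iInter, Set.mem_preimage]
    rfl
  rw [hiwahori]
  refine .inter ?_ ((isClopen_valuation_lt_one F).preimage (continuous_apply_apply 1 0))
  exact isClopen_iInter_of_finite fun i => isClopen_iInter_of_finite fun j =>
    (valuation F).isClopen_integer.preimage (continuous_apply_apply i j)

variable (F) in
theorem t1Space : T1Space F := by
  refine IsTopologicalAddGroup.t1Space F ?_
  simpa using (valuation F).isClosed_closedBall 0

variable (F) in
theorem isCompact_iwahori : IsCompact (iwahori F : Set SL(2, F)) := by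
  have := t1Space F
  have hentries : IsCompact {A : Matrix (Fin 2) (Fin 2) F | ∀ i, A i ∈ {x | ∀ j, x j ∈ 𝒪[F]}} :=
    isCompact_pi_infinite fun _ => isCompact_pi_infinite fun _ =>
      IsNonarchimedeanLocalField.isCompact_closedBall F 1
  exact (SpecialLinearGroup.isClosedEmbedding_val.isCompact_preimage hentries).of_isClosed_subset
    (isClopen_iwahori F).isClosed fun g hg => valuation_le_one_of_mem_iwahori hg

theorem isSchwartz_of_forall_norm_le {ϖ : Fˣ} (hϖ : IsUniformizer ϖ) {f : SL(2, F) → ℂ}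
    (hinv : ∀ u ∈ iwahori F, ∀ v ∈ iwahori F, ∀ g, f (u * g * v) = f g)
    (hf : ∃ C, 0 ≤ C ∧ ∀ w, ∀ g ∈ iwahoriCell ϖ w, ‖f g‖ ≤ C * ((resCard F : ℝ)⁻¹) ^ len w) :
    IsSchwartz ϖ f := by
  refine ⟨⟨iwahori F, (isClopen_iwahori F).isOpen, isCompact_iwahori F, hinv⟩, fun p m hm => ?_⟩
  set q : ℝ := (resCard F : ℝ)
  have hq : 1 < q := Nat.one_lt_cast.2 (one_lt_resCard F)
  have hq₀ : 0 < q := zero_lt_one.trans hq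
  obtain ⟨C, hC, hf⟩ := hf
  obtain ⟨A, hA, hlog⟩ := exists_log_one_add_absF_le hϖ p
  obtain ⟨B, hB, hpow⟩ := exists_forall_rpow_le_mul_pow hq m
  refine ⟨C * (A ^ m * B) * q ^ 2, fun g => ?_⟩
  obtain ⟨w, hw⟩ := exists_mem_iwahoriCell hϖ g
  obtain ⟨n, hn, hg⟩ := exists_mem_doubleCoset_of_mem_iwahoriCell hw
  have hdelta : cartanDelta ϖ g ≤ q ^ n := pow_le_pow_right₀ hq.le (Nat.sInf_le hg)
  have hlog₀ : 0 ≤ Real.log (1 + absF (polyFun p g)) := by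
    rw [absF_eq]
    exact Real.log_nonneg (le_add_of_nonneg_right NNReal.zero_le_coe)
  have hlogm : Real.log (1 + absF (polyFun p g)) ^ m ≤ A ^ m * (B * q ^ (n + 1)) :=
    calc Real.log (1 + absF (polyFun p g)) ^ m ≤ (A * (n + 1)) ^ m :=
          Real.rpow_le_rpow hlog₀ (hlog n g hg) hm.le
      _ = A ^ m * ((n + 1 : ℕ) : ℝ) ^ m := by
          rw [Nat.cast_add_one, Real.mul_rpow hA (by positivity)]
      _ ≤ A ^ m * (B * q ^ (n + 1)) := by
          gcongr
          exact hpow (n + 1)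
  have hlen : q ^ (2 * n) * (q⁻¹) ^ len w ≤ q := by
    rw [inv_pow, ← div_eq_mul_inv, div_le_iff₀ (pow_pos hq₀ _), ← pow_succ']
    exact pow_le_pow_right₀ hq.le hn
  calc cartanDelta ϖ g * ‖f g‖ * Real.log (1 + absF (polyFun p g)) ^ m
      ≤ q ^ n * (C * (q⁻¹) ^ len w) * (A ^ m * (B * q ^ (n + 1))) := by
        gcongr
        exact hf w g hw
    _ = C * (A ^ m * B) * q * (q ^ (2 * n) * (q⁻¹) ^ len w) := by ring
    _ ≤ C * (A ^ m * B) * q * q := by gcongr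
    _ = C * (A ^ m * B) * q ^ 2 := by ring

variable (F) in
theorem inv_sqrt_resCard_pos : 0 < (Real.sqrt (resCard F))⁻¹ :=
  inv_pos.2 (Real.sqrt_pos.2 (Nat.cast_pos.2 (zero_lt_one.trans (one_lt_resCard F))))

variable (F) in
theorem inv_sqrt_resCard_lt_one : (Real.sqrt (resCard F))⁻¹ < 1 :=
  inv_lt_one_of_one_lt₀ (Real.lt_sqrt_of_sq_lt (by simpa using one_lt_resCard F))

theorem represents_preimageT_iff {ϖ : Fˣ} {y : AffineWeyl} {f : SL(2, F) → ℂ} :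
    Represents ϖ (preimageT y) f ↔
      ∀ w, ∀ g ∈ iwahoriCell ϖ w, f g = (valueT (Real.sqrt (resCard F))⁻¹ y w : ℂ) := by
  have hsum (w : AffineWeyl) : HasSum (fun k : ℤ => (tCoeff (preimageT y) w k : ℂ) *
      (((Real.sqrt (resCard F))⁻¹ : ℝ) : ℂ) ^ k) (valueT (Real.sqrt (resCard F))⁻¹ y w : ℂ) := by
    convert! Complex.hasSum_ofReal.2 (hasSum_tCoeff_preimageT (inv_sqrt_resCard_pos F)
      (inv_sqrt_resCard_lt_one F) y w) using 2 with k
    push_cast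
    rfl
  refine ⟨fun hf w g hg => (hf w g hg).unique (hsum w), fun hf w g hg => ?_⟩
  rw [hf w g hg]
  exact hsum w

theorem Represents.bi_invariant {ϖ : Fˣ} (hϖ : IsUniformizer ϖ) {a : AffineWeyl → LaurentSeries ℤ}
    {f : SL(2, F) → ℂ} (hf : Represents ϖ a f) :
    ∀ u ∈ iwahori F, ∀ v ∈ iwahori F, ∀ g, f (u * g * v) = f g := by
  intro u hu v hv g
  obtain ⟨w, hw⟩ := exists_mem_iwahoriCell hϖ g
  exact (hf w _ (mul_mem_iwahoriCell hu hv hw)).unique (hf w g hw)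

theorem Represents.isSchwartz {ϖ : Fˣ} (hϖ : IsUniformizer ϖ) {y : AffineWeyl} {f : SL(2, F) → ℂ}
    (hf : Represents ϖ (preimageT y) f) : IsSchwartz ϖ f := by
  obtain ⟨C, hC, hvalue⟩ := exists_abs_valueT_le (inv_sqrt_resCard_pos F)
    (inv_sqrt_resCard_lt_one F) y
  refine isSchwartz_of_forall_norm_le hϖ (hf.bi_invariant hϖ) ⟨C, hC, fun w g hg => ?_⟩
  rw [represents_preimageT_iff.1 hf w g hg, Complex.norm_real, Real.norm_eq_abs]
  simpa only [inv_pow, Real.sq_sqrt (Nat.cast_nonneg (resCard F))] using hvalue w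

theorem existsUnique_represents_preimageT {ϖ : Fˣ} (hϖ : IsUniformizer ϖ) (y : AffineWeyl) :
    ∃! f : SL(2, F) → ℂ, Represents ϖ (preimageT y) f := by
  simp only [represents_preimageT_iff]
  choose cell hcell using fun g : SL(2, F) => exists_mem_iwahoriCell hϖ g
  refine ⟨fun g => (valueT (Real.sqrt (resCard F))⁻¹ y (cell g) : ℂ), fun w g hg => ?_,
    fun f hf => funext fun g => hf _ g (hcell g)⟩
  rw [eq_of_mem_iwahoriCell hϖ hg (hcell g)]

end LocalField

end AsymptoticHecke

end

open AsymptoticHecke in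
theorem mainTheorem8 (F : Type*) [Field F] [ValuativeRel F] [TopologicalSpace F]
    [IsNonarchimedeanLocalField F] (ϖ : Fˣ) (hϖ : IsUniformizer ϖ) (y : AffineWeyl) :
    (∃! a, IsPreimageT y a) ∧
    ∀ a, IsPreimageT y a →
      (∃! f : SL(2, F) → ℂ, Represents ϖ a f) ∧
      ∀ f : SL(2, F) → ℂ, Represents ϖ a f →
        (y ≠ 1 → ∀ w, ∀ g ∈ iwahoriCell ϖ w, f g = (explicitCoeff (resCard F) y w : ℂ)) ∧
        (∀ u ∈ iwahori F, ∀ v ∈ iwahori F, ∀ g, f (u * g * v) = f g) ∧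
        IsSchwartz ϖ f := by
  refine ⟨⟨preimageT y, isPreimageT_iff.2 rfl, fun a ha => isPreimageT_iff.1 ha⟩, fun a ha => ?_⟩
  obtain rfl := isPreimageT_iff.1 ha
  refine ⟨existsUnique_represents_preimageT hϖ y, fun f hf =>
    ⟨fun hy w g hg => ?_, hf.bi_invariant hϖ, hf.isSchwartz hϖ⟩⟩
  have hq : (0 : ℝ) < resCard F := Nat.cast_pos.2 (zero_lt_one.trans (one_lt_resCard F))
  rw [represents_preimageT_iff.1 hf w g hg, valueT_eq_explicitCoeff hq hy]
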